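/- All graphs are finite, simple and undirected. For a graph $G$ of order $n$, let $p(G,r)$ denote the number of sets of $r$ pairwise non-incident edges of $G$ (so $p(G,0)=1$), and let $$\mu(G,x)=\sum_{r=0}^{\lfloor n/2\rfloor}(-1)^r\,p(G,r)\,x^{n-2r}$$ be the matching polynomial of $G$. Call $G$ matching integral if all zeros of $\mu(G,x)$ are integers, and claw-free if no induced subgraph of $G$ is isomorphic to $K_{1,3}$. Let $G_2$ be the graph on the five vertices $a,b,c,d,e$ with edges $ab, ac, bc, bd, de$ (a triangle with a path of length $2$ attached at one of its vertices). **Theorem.** Let $G$ be a connected matching integral claw-free graph. Then $G$ is isomorphic to $K_1$, $K_2$ or $G_2$. -/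

import Mathlib

namespace SimpleGraph

open Polynomial

variable {V : Type*}

/-- A set `M` of edges of `G` is a matching if its edges are pairwise non-incident, that is,
two different edges of `M` have no end vertex in common. -/
def IsEdgeMatching (G : SimpleGraph V) (M : Finset (Sym2 V)) : Prop :=
  (∀ e ∈ M, e ∈ G.edgeSet) ∧ ∀ e ∈ M, ∀ f ∈ M, e ≠ f → ∀ v : V, ¬ (v ∈ e ∧ v ∈ f)

/-- The number `p(G, r)` of `r`-matchings of a (finite) graph `G`. -/
noncomputable def numMatchings (G : SimpleGraph V) (r : ℕ) : ℕ :=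
  {M : Finset (Sym2 V) | M.card = r ∧ G.IsEdgeMatching M}.ncard

/-- The matching polynomial `μ(G, x) = ∑_{r = 0}^{⌊n/2⌋} (-1)^r p(G, r) x^{n - 2r}` of a finite
graph `G` of order `n`. In every term `2 * r ≤ n`, so the subtraction does not truncate. -/
noncomputable def matchingPolynomial (G : SimpleGraph V) : ℤ[X] :=
  ∑ r ∈ Finset.range (Nat.card V / 2 + 1),
    C ((-1) ^ r * (G.numMatchings r : ℤ)) * X ^ (Nat.card V - 2 * r)

/-- A graph is matching integral if all (complex) zeros of its matching polynomial are
integers. -/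
def IsMatchingIntegral (G : SimpleGraph V) : Prop :=
  ∀ z : ℂ, aeval z G.matchingPolynomial = 0 → ∃ k : ℤ, z = (k : ℂ)

/-- A graph is claw-free if it has no induced subgraph isomorphic to the claw `K_{1,3}`. -/
def IsClawFree (G : SimpleGraph V) : Prop :=
  ¬ (completeBipartiteGraph (Fin 1) (Fin 3)).IsIndContained G

/-- The graph `G₂`: a triangle `0, 1, 2` with a path `1, 3, 4` attached at the vertex `1`. -/
def graphG2 : SimpleGraph (Fin 5) :=
  SimpleGraph.fromEdgeSet {s(0, 1), s(0, 2), s(1, 2), s(1, 3), s(3, 4)}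

end SimpleGraph

/-!
The matching polynomials `f S = μ(G[S], x)` of the induced subgraphs satisfy
`f S = x f (S - u) - ∑ f (S - u - w)`, the sum being over the neighbours `w` of `u` in `S`
(`MatchRec`). By induction, `f (S - u) f (S - v) - f S f (S - u - v)` is a sum of squares
of real polynomials (`MatchRec.rayleigh`), with `f (S - u - v) ^ 2` among them if `u` and `v`
are adjacent; this remains true for real vertex weights. Also `f' S = ∑ f (S - v)`.

These facts show that the zeros of a connected claw-free graph are simple
(`NoClaw.not_sq_dvd`). Suppose `θ` is a multiple zero, and use induction. In a connected claw-free
graph the deletion of a vertex leaves at most two components, so `θ` has multiplicity at most two in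
`f (S - v)`. The Rayleigh inequality shows that `θ` is a zero of every `f (S - v)`, and of
`f (S - u - v)` for adjacent `u`, `v`. It is a simple zero of `f (S - v)` if `v` is not a cut vertex,
and by the sign of the Rayleigh difference near `θ` the same follows for the neighbours of `v`, hence
for all vertices (`MatchRec.sq_dvd_erase_of_adj`). A perturbation of the weight of one vertex
shows that `f (S - u - v) (θ) = 0` is a transitive relation between `u` and `v`
(`MatchRec.derivative_mul_eval_eq_zero`), so it holds for all pairs. Then
`f' (S - u) (θ) = ∑ f (S - u - v) (θ) = 0`, which contradicts simplicity.

If `G` is also matching integral, then `μ(G, x) = x ^ ε ∏ (x ^ 2 - a ^ 2)` with `ε ≤ 1` and `a` running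
through a set `T` of `m` positive integers, where `n = 2 m + ε`
(`exists_matchingPolynomial_eq_prod`). The coefficients give the number of edges
`∑ a ^ 2` and the sum `∑ a ^ 2 + ∑ a ^ 4` of the squared degrees. Since there are at most
`n (n - 1) / 2` edges, while `∑ a ^ 2` is at least `1 ^ 2 + ⋯ + m ^ 2`, it follows that `m ≤ 5`. The
Cauchy–Schwarz inequality for the degrees and the bound `d ≤ n - 1` on each degree `d` leave, for
`m ≥ 2`, only `n = 5`, `T = {1, 2}` and `n = 7`, `T = {1, 2, 3}` (`eq_of_sum_sq_le`). In the first case the degrees are `3, 2, 2, 2, 1` and claw-freeness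
leaves only `G₂`. In the second case `G` is 4-regular, and counting triangles shows that a
claw-free 4-regular graph of order 7 does not have `1 * 4 * 9` matchings of size three
(`NoClaw.coeff_one_ne`).
-/

open Polynomial

namespace SimpleGraph

variable {V : Type*} [DecidableEq V]

/-! ### The vertex recurrence and the Rayleigh inequality -/

/-- The recurrence of the vertex-weighted matching polynomials `f S = μ(G[S]; x)` of the induced
subgraphs of `G`: the vertex `u ∈ S` is either left uncovered or matched to one of its
neighbours. -/
structure MatchRec {R : Type*} [CommRing R] (G : SimpleGraph V) [DecidableRel G.Adj] (x : V → R)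
    (f : Finset V → R) : Prop where
  empty : f ∅ = 1
  step : ∀ S : Finset V, ∀ u ∈ S, f S = x u * f (S.erase u) -
    ∑ w ∈ S.erase u with G.Adj u w, f ((S.erase u).erase w)

namespace MatchRec

variable {R : Type*} [CommRing R] {G : SimpleGraph V} [DecidableRel G.Adj] {x : V → R}
  {f : Finset V → R}

theorem map {R' : Type*} [CommRing R'] (h : MatchRec G x f) (φ : R →+* R') :
    MatchRec G (fun v => φ (x v)) (fun S => φ (f S)) where
  empty := by simp [h.empty]
  step S u hu := by rw [h.step S u hu]; simp

/-- Raising the weight of a single vertex `w` by `t` adds `t` times the polynomial of the graph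
without `w`. -/
theorem raise (h : MatchRec G x f) (w : V) (t : R) :
    MatchRec G (fun v => if v = w then x v + t else x v)
      (fun S => if w ∈ S then f S + t * f (S.erase w) else f S) where
  empty := by simp [h.empty]
  step S u hu := by
    by_cases huw : u = w
    · subst huw
      simp [hu, h.step S u hu]
      ring
    · have hwu : w ≠ u := fun e => huw e.symm
      by_cases hw : w ∈ S
      · have hu' : u ∈ S.erase w := Finset.mem_erase.2 ⟨huw, hu⟩
        have e1 := h.step S u hu
        have e2 := h.step (S.erase w) u hu'
        simp only [hw, if_true, huw, if_false, Finset.mem_erase, hwu, ne_eq, not_false_eq_true,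
          and_self, and_true]
        have e3 : ∑ z ∈ S.erase u with G.Adj u z,
            (if ¬ w = z then f ((S.erase u).erase z) + t * f (((S.erase u).erase z).erase w)
              else f ((S.erase u).erase z)) =
            ∑ z ∈ S.erase u with G.Adj u z, f ((S.erase u).erase z) +
            t * ∑ z ∈ (S.erase w).erase u with G.Adj u z, f (((S.erase w).erase u).erase z) := by
          have : (S.erase w).erase u = (S.erase u).erase w := Finset.erase_right_comm
          have hf : ((S.erase u).erase w).filter (G.Adj u) =
              ((S.erase u).filter (G.Adj u)).filter (fun z => w ≠ z) := by
            ext z; simp only [Finset.mem_filter, Finset.mem_erase]; tauto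
          rw [this, Finset.mul_sum, hf,
            Finset.sum_filter (p := fun z => w ≠ z), ← Finset.sum_add_distrib]
          refine Finset.sum_congr rfl fun z _ => ?_
          by_cases hz : w = z
          · simp [hz]
          · simp [hz, Finset.erase_right_comm (a := z) (b := w)]
        rw [e3, e1, e2, Finset.erase_right_comm (a := w) (b := u)]
        ring
      · simp only [hw, huw, if_false, Finset.mem_erase, and_false]
        exact h.step S u hu

/-- Summing the recurrence over all vertices. -/
theorem sum_adj (h : MatchRec G x f) (S : Finset V) :
    ∑ u ∈ S, ∑ w ∈ S.erase u with G.Adj u w, f ((S.erase u).erase w) =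
      ∑ u ∈ S, x u * f (S.erase u) - S.card * f S := by
  rw [← nsmul_eq_mul, ← Finset.sum_const, ← Finset.sum_sub_distrib]
  refine Finset.sum_congr rfl fun u hu => ?_
  rw [h.step S u hu]; ring

/-- The polynomial of a disjoint union is the product of the polynomials. -/
theorem union (h : MatchRec G x f) (A B : Finset V) (hd : Disjoint A B)
    (hn : ∀ a ∈ A, ∀ b ∈ B, ¬ G.Adj a b) : f (A ∪ B) = f A * f B := by
  induction hk : A.card using Nat.strong_induction_on generalizing A with
  | _ k ih =>
    rcases A.eq_empty_or_nonempty with rfl | ⟨u, hu⟩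
    · simp [h.empty]
    have huB : u ∉ B := Finset.disjoint_left.1 hd hu
    have e1 : ∀ C : Finset V, C ⊆ A → C ≠ A → f (C ∪ B) = f C * f B := fun C hC hne =>
      ih C.card (hk ▸ Finset.card_lt_card (hC.ssubset_of_ne hne)) C
        (Finset.disjoint_of_subset_left hC hd) (fun a ha => hn a (hC ha)) rfl
    have e2 : (A ∪ B).erase u = A.erase u ∪ B := by
      rw [Finset.erase_union_distrib, Finset.erase_eq_of_notMem huB]
    have hne : A.erase u ≠ A := fun e => Finset.notMem_erase u A (by rw [e]; exact hu)
    rw [h.step _ u (Finset.mem_union_left _ hu), h.step A u hu, e2,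
      e1 _ (Finset.erase_subset _ _) hne, sub_mul, Finset.sum_mul, mul_assoc]
    congr 1
    have e3 : (A.erase u ∪ B).filter (G.Adj u) = (A.erase u).filter (G.Adj u) := by
      ext z
      simp only [Finset.mem_filter, Finset.mem_union]
      constructor
      · rintro ⟨hz | hz, ha⟩
        · exact ⟨hz, ha⟩
        · exact absurd ha (hn u hu z hz)
      · rintro ⟨hz, ha⟩
        exact ⟨Or.inl hz, ha⟩
    rw [e3]
    refine Finset.sum_congr rfl fun z hz => ?_
    have hzA : z ∈ A.erase u := (Finset.mem_filter.1 hz).1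
    have hzB : z ∉ B := Finset.disjoint_left.1 hd (Finset.mem_of_mem_erase hzA)
    rw [Finset.erase_union_distrib, Finset.erase_eq_of_notMem hzB,
      e1 _ ((Finset.erase_subset _ _).trans (Finset.erase_subset _ _))]
    intro e
    apply Finset.notMem_erase z (A.erase u)
    rw [e]; exact Finset.mem_of_mem_erase hzA

/-- The Rayleigh inequality. The difference
`R_S(u, v) = f (S - u) f (S - v) - f S f (S - u - v)` is a sum of squares: expanding `f S` and
`f (S - v)` at `u` expresses it through the differences `R_{S - u}(w, v)` with `w` adjacent to `u`,
and the square of `f (S - u - v)` if `v` is adjacent to `u`. -/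
theorem rayleigh {x : V → ℝ} {f : Finset V → ℝ} (h : MatchRec G x f) (S : Finset V) {u v : V}
    (hu : u ∈ S) (hv : v ∈ S) (huv : u ≠ v) :
    (if G.Adj u v then f ((S.erase u).erase v) ^ 2 else 0) ≤
      f (S.erase u) * f (S.erase v) - f S * f ((S.erase u).erase v) := by
  induction hk : S.card using Nat.strong_induction_on generalizing S u v with
  | _ k ih =>
    have hu' : u ∈ S.erase v := Finset.mem_erase.2 ⟨huv, hu⟩
    have hv' : v ∈ S.erase u := Finset.mem_erase.2 ⟨huv.symm, hv⟩
    have e1 := h.step S u hu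
    have e2 := h.step (S.erase v) u hu'
    have e0 : (S.erase v).erase u = (S.erase u).erase v := Finset.erase_right_comm
    rw [e0] at e2
    have e3 : ∑ w ∈ S.erase u with G.Adj u w, f ((S.erase u).erase w) =
        ∑ w ∈ (S.erase u).erase v with G.Adj u w, f ((S.erase u).erase w) +
          if G.Adj u v then f ((S.erase u).erase v) else 0 := by
      rw [Finset.sum_filter, Finset.sum_filter, Finset.sum_erase_add _ _ hv']
    have e4 : 0 ≤ ∑ w ∈ (S.erase u).erase v with G.Adj u w,
        (f ((S.erase u).erase w) * f ((S.erase u).erase v) -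
          f (S.erase u) * f (((S.erase u).erase v).erase w)) := by
      refine Finset.sum_nonneg fun w hw => ?_
      have hw' := (Finset.mem_filter.1 hw).1
      have := ih (S.erase u).card (by rw [← hk]; exact Finset.card_erase_lt_of_mem hu) (S.erase u)
        (Finset.mem_of_mem_erase hw') hv' (Finset.ne_of_mem_erase hw') rfl
      rw [Finset.erase_right_comm (a := w) (b := v)] at this
      refine le_trans ?_ this
      split_ifs <;> positivity
    rw [Finset.sum_sub_distrib, ← Finset.sum_mul, ← Finset.mul_sum] at e4
    rw [e1, e2, e3]
    split_ifs with ha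
    · nlinarith
    · nlinarith

/-- The derivative of the matching polynomial is the sum over the vertex-deleted subgraphs. -/
theorem derivative {f : Finset V → R[X]} (h : MatchRec G (fun _ => X) f) (S : Finset V) :
    Polynomial.derivative (f S) = ∑ v ∈ S, f (S.erase v) := by
  induction hk : S.card using Nat.strong_induction_on generalizing S with
  | _ k ih =>
    rcases S.eq_empty_or_nonempty with rfl | ⟨u, hu⟩
    · simp [h.empty]
    have hlt : (S.erase u).card < k := hk ▸ Finset.card_erase_lt_of_mem hu
    have e1 := ih _ hlt (S.erase u) rfl
    have e2 : ∀ w ∈ S.erase u, Polynomial.derivative (f ((S.erase u).erase w)) =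
        ∑ v ∈ (S.erase u).erase w, f (((S.erase u).erase w).erase v) := fun w hw =>
      ih _ ((Finset.card_erase_lt_of_mem hw).trans hlt) _ rfl
    rw [h.step S u hu, ← Finset.add_sum_erase S (fun v => f (S.erase v)) hu]
    have e3 : ∀ v ∈ S.erase u, f (S.erase v) = X * f ((S.erase u).erase v) -
        ∑ w ∈ (S.erase u).erase v with G.Adj u w, f (((S.erase u).erase w).erase v) := by
      intro v hv
      rw [h.step (S.erase v) u (Finset.mem_erase.2 ⟨(Finset.ne_of_mem_erase hv).symm, hu⟩),
        Finset.erase_right_comm (a := v) (b := u)]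
      congr 1
      refine Finset.sum_congr rfl fun w _ => ?_
      rw [Finset.erase_right_comm (a := v) (b := w)]
    rw [Finset.sum_congr rfl e3, Finset.sum_sub_distrib, ← Finset.mul_sum, ← e1]
    simp only [Polynomial.derivative_sub, Polynomial.derivative_mul, Polynomial.derivative_X,
      one_mul, Polynomial.derivative_sum]
    rw [add_sub_assoc]
    congr 2
    rw [Finset.sum_congr rfl fun w hw => e2 w (Finset.mem_filter.1 hw).1]
    refine Finset.sum_comm' fun w v => ?_
    simp only [Finset.mem_filter, Finset.mem_erase]
    tauto

end MatchRec

end SimpleGraph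

namespace SimpleGraph

variable {V : Type*} [DecidableEq V]

/-! ### Multiple zeros and vertex deletion -/

theorem sq_dvd_iff_eval_derivative (p : ℝ[X]) (θ : ℝ) :
    (X - C θ) ^ 2 ∣ p ↔ p.eval θ = 0 ∧ (derivative p).eval θ = 0 := by
  constructor
  · rintro ⟨q, rfl⟩
    simp [derivative_pow]
  · rintro ⟨h0, h1⟩
    obtain ⟨q, rfl⟩ := dvd_iff_isRoot.2 h0
    have h2 : q.eval θ = 0 := by simpa using h1
    obtain ⟨r, rfl⟩ := dvd_iff_isRoot.2 h2
    exact ⟨r, by ring⟩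

theorem eval_nonneg_of_ne {p : ℝ[X]} {θ : ℝ} (h : ∀ y, y ≠ θ → 0 ≤ p.eval y) :
    0 ≤ p.eval θ :=
  ge_of_tendsto (p.continuous.continuousAt.tendsto.mono_left nhdsWithin_le_nhds :
    Filter.Tendsto (fun y => p.eval y) (nhdsWithin θ {θ}ᶜ) (nhds (p.eval θ)))
    (eventually_nhdsWithin_of_forall fun y hy => h y hy)

theorem eval_eq_zero_of_mul_nonneg {p : ℝ[X]} {θ : ℝ}
    (h : ∀ y, y ≠ θ → 0 ≤ (y - θ) * p.eval y) : p.eval θ = 0 := by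
  apply le_antisymm
  · refine le_of_tendsto (p.continuous.continuousAt.tendsto.mono_left nhdsWithin_le_nhds :
      Filter.Tendsto (fun y => p.eval y) (nhdsWithin θ (Set.Iio θ)) (nhds (p.eval θ)))
      (eventually_nhdsWithin_of_forall fun y hy => ?_)
    have hy' : y < θ := hy
    have := h y hy'.ne
    nlinarith
  · refine ge_of_tendsto (p.continuous.continuousAt.tendsto.mono_left nhdsWithin_le_nhds :
      Filter.Tendsto (fun y => p.eval y) (nhdsWithin θ (Set.Ioi θ)) (nhds (p.eval θ)))
      (eventually_nhdsWithin_of_forall fun y hy => ?_)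
    have hy' : θ < y := hy
    have := h y hy'.ne'
    nlinarith

namespace MatchRec

variable {G : SimpleGraph V} [DecidableRel G.Adj] {f : Finset V → ℝ[X]} {θ : ℝ}

theorem eval (h : MatchRec G (fun _ => X) f) (y : ℝ) :
    MatchRec G (fun _ => y) (fun S => (f S).eval y) := by
  simpa using h.map (evalRingHom y)

/-- At a multiple root `θ` of `f S`, the identity `f' S = ∑ u, f (S - u)` gives
`0 = ∑ u, f (S - u) f (S - v)`, in which no term is negative by the Rayleigh inequality. -/
theorem eval_erase_eq_zero (h : MatchRec G (fun _ => X) f) {S : Finset V}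
    (hd : (X - C θ) ^ 2 ∣ f S) {v : V} (hv : v ∈ S) : (f (S.erase v)).eval θ = 0 := by
  obtain ⟨h0, h1⟩ := (sq_dvd_iff_eval_derivative _ _).1 hd
  rw [h.derivative, eval_finsetSum] at h1
  have h2 : ∑ u ∈ S, (f (S.erase u)).eval θ * (f (S.erase v)).eval θ = 0 := by
    rw [← Finset.sum_mul, h1, zero_mul]
  have h3 : ∀ u ∈ S, 0 ≤ (f (S.erase u)).eval θ * (f (S.erase v)).eval θ := by
    intro u hu
    rcases eq_or_ne u v with rfl | huv
    · exact mul_self_nonneg _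
    · have := (h.eval θ).rayleigh S hu hv huv
      rw [h0, zero_mul, sub_zero] at this
      refine le_trans ?_ this
      split_ifs <;> positivity
  exact mul_self_eq_zero.1 ((Finset.sum_eq_zero_iff_of_nonneg h3).1 h2 v hv)

/-- The Rayleigh inequality at `θ` reduces to `f (S - u - v) ^ 2 ≤ 0`. -/
theorem eval_erase_erase_eq_zero (h : MatchRec G (fun _ => X) f) {S : Finset V}
    (hd : (X - C θ) ^ 2 ∣ f S) {u v : V} (hu : u ∈ S) (hv : v ∈ S) (ha : G.Adj u v) :
    (f ((S.erase u).erase v)).eval θ = 0 := by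
  have h0 := ((sq_dvd_iff_eval_derivative _ _).1 hd).1
  have := (h.eval θ).rayleigh S hu hv ha.ne
  simp only [ha, if_true, h0, h.eval_erase_eq_zero hd hv] at this
  nlinarith [sq_nonneg ((f ((S.erase u).erase v)).eval θ)]

/-- Non-adjacency in the sense `f (S - u - v) (θ) = 0` is transitive through a vertex `v` whose
deletion leaves a simple root: otherwise the Rayleigh inequality for `u, v`, in which the weight of
`w` is moved by `σ (y - θ)`, divided by `(y - θ) ^ 2`, becomes
`0 ≤ (f' (S - u) + σ f (S - u - w)) * f' (S - v)` at `y = θ`, for every real `σ`. -/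
theorem derivative_mul_eval_eq_zero (h : MatchRec G (fun _ => X) f) {S : Finset V}
    (hd : (X - C θ) ^ 2 ∣ f S) {u v w : V} (hu : u ∈ S) (hv : v ∈ S) (hw : w ∈ S)
    (huv : u ≠ v) (huw : u ≠ w) (hvw : v ≠ w)
    (h1 : (f ((S.erase u).erase v)).eval θ = 0) (h2 : (f ((S.erase v).erase w)).eval θ = 0) :
    (Polynomial.derivative (f (S.erase v))).eval θ * (f ((S.erase u).erase w)).eval θ = 0 := by
  obtain ⟨a, ha⟩ := hd
  obtain ⟨p, hp⟩ := dvd_iff_isRoot.2 (h.eval_erase_eq_zero ⟨a, ha⟩ hu)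
  obtain ⟨q, hq⟩ := dvd_iff_isRoot.2 (h.eval_erase_eq_zero ⟨a, ha⟩ hv)
  obtain ⟨r, hr⟩ := dvd_iff_isRoot.2 (h.eval_erase_eq_zero ⟨a, ha⟩ hw)
  have key : ∀ σ : ℝ, 0 ≤ (p.eval θ + σ * (f ((S.erase u).erase w)).eval θ) * q.eval θ := by
    intro σ
    have hP : ∀ y, y ≠ θ → 0 ≤ ((p + C σ * f ((S.erase u).erase w)) *
        (q + C σ * f ((S.erase v).erase w)) - (a + C σ * r) *
          (f ((S.erase u).erase v) +
            C σ * ((X - C θ) * f (((S.erase u).erase v).erase w)))).eval y := by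
      intro y hy
      have hR := ((h.eval y).raise w (σ * (y - θ))).rayleigh S hu hv huv
      have hR0 := le_trans (by split_ifs <;> positivity) hR
      simp only [hw, Finset.mem_erase, ne_eq, huw.symm, hvw.symm, not_false_eq_true, and_self,
        if_true, ha, hp, hq, hr] at hR0
      have hpos : 0 < (y - θ) ^ 2 := by have := sub_ne_zero.2 hy; positivity
      refine nonneg_of_mul_nonneg_right (a := (y - θ) ^ 2) ?_ hpos
      refine hR0.trans_eq ?_
      simp only [eval_mul, eval_add, eval_sub, eval_pow, eval_X, eval_C]
      ring
    have := eval_nonneg_of_ne hP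
    simpa [h1, h2] using this
  have hq' : (Polynomial.derivative (f (S.erase v))).eval θ = q.eval θ := by rw [hq]; simp
  rw [hq']
  by_contra hne
  obtain ⟨hne1, hne2⟩ := mul_ne_zero_iff.1 hne
  -- this `σ` makes the right-hand side of `key` equal to `-1`
  have := key (-(1 + p.eval θ * q.eval θ) / (q.eval θ * (f ((S.erase u).erase w)).eval θ))
  have e : (p.eval θ + -(1 + p.eval θ * q.eval θ) / (q.eval θ * (f ((S.erase u).erase w)).eval θ) *
      (f ((S.erase u).erase w)).eval θ) * q.eval θ = -1 := by
    field_simp; ring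
  linarith

/-- Let `θ` be a multiple root of `f S`. If `θ` is a root of `f (S - v)` of multiplicity exactly
two, then it is a multiple root of `f (S - u)` for every neighbour `u` of `v`: otherwise the
Rayleigh difference of `u, v` would change sign at `θ`. -/
theorem sq_dvd_erase_of_adj (h : MatchRec G (fun _ => X) f) {S : Finset V}
    (hd : (X - C θ) ^ 2 ∣ f S) {u v : V} (hu : u ∈ S) (hv : v ∈ S) (huv : G.Adj u v)
    (h2 : (X - C θ) ^ 2 ∣ f (S.erase v)) (h3 : ¬ (X - C θ) ^ 3 ∣ f (S.erase v)) :
    (X - C θ) ^ 2 ∣ f (S.erase u) := by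
  have hd0 := h.eval_erase_eq_zero h2 (Finset.mem_erase.2 ⟨huv.ne, hu⟩)
  rw [Finset.erase_right_comm] at hd0
  obtain ⟨a, ha⟩ := hd
  obtain ⟨b, hb⟩ := dvd_iff_isRoot.2 (h.eval_erase_eq_zero ⟨a, ha⟩ hu)
  obtain ⟨c, hc⟩ := h2
  obtain ⟨e, he⟩ := dvd_iff_isRoot.2 hd0
  have hc0 : c.eval θ ≠ 0 := by
    intro h0
    obtain ⟨c', rfl⟩ := dvd_iff_isRoot.2 h0
    exact h3 ⟨c', by rw [hc]; ring⟩
  have hR : ∀ y, y ≠ θ → (e.eval y) ^ 2 ≤ (y - θ) * (b * c - a * e).eval y := by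
    intro y hy
    have hR := (h.eval y).rayleigh S hu hv huv.ne
    simp only [huv, if_true, ha, hb, hc, he, eval_mul, eval_pow, eval_sub, eval_X, eval_C] at hR
    have hpos : 0 < (y - θ) ^ 2 := by have := sub_ne_zero.2 hy; positivity
    refine le_of_mul_le_mul_left ?_ hpos
    simp only [eval_mul, eval_sub]
    nlinarith
  have h4 : (b * c - a * e).eval θ = 0 :=
    eval_eq_zero_of_mul_nonneg fun y hy => (sq_nonneg _).trans (hR y hy)
  have h5 : e.eval θ = 0 := by
    have := eval_nonneg_of_ne (p := (X - C θ) * (b * c - a * e) - e ^ 2) (θ := θ) fun y hy => by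
      simpa using hR y hy
    simp only [eval_sub, eval_mul, eval_X, eval_C, sub_self, zero_mul, eval_pow] at this
    nlinarith [sq_nonneg (e.eval θ)]
  have h6 : b.eval θ = 0 := by
    have : b.eval θ * c.eval θ = 0 := by simpa [h5] using h4
    exact (mul_eq_zero.1 this).resolve_right hc0
  obtain ⟨b', rfl⟩ := dvd_iff_isRoot.2 h6
  exact ⟨b', by rw [hb]; ring⟩

end MatchRec

/-! ### Connected vertex sets in claw-free graphs -/

/-- The set `S` of vertices induces a connected subgraph, in terms of cuts: it is nonempty and
every proper nonempty part of it is joined to the rest by an edge. -/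
def CutConnected (G : SimpleGraph V) (S : Finset V) : Prop :=
  S.Nonempty ∧ ∀ A ⊆ S, A.Nonempty → A ≠ S → ∃ a ∈ A, ∃ b ∈ S \ A, G.Adj a b

variable {G : SimpleGraph V}

theorem exists_split_of_not_cutConnected {S : Finset V} (hS : S.Nonempty)
    (h : ¬ G.CutConnected S) : ∃ A B : Finset V, A.Nonempty ∧ B.Nonempty ∧ Disjoint A B ∧
      A ∪ B = S ∧ ∀ a ∈ A, ∀ b ∈ B, ¬ G.Adj a b := by
  simp only [CutConnected, hS, true_and] at h
  push Not at h
  obtain ⟨A, hA, hne, hAS, hn⟩ := h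
  refine ⟨A, S \ A, hne, ?_, Finset.disjoint_sdiff, Finset.union_sdiff_of_subset hA, hn⟩
  exact Finset.sdiff_nonempty.2 fun hs => hAS (hA.antisymm hs)

namespace CutConnected

theorem exists_adj_of_erase {S : Finset V} (h : G.CutConnected S) {v : V} (hv : v ∈ S)
    {A : Finset V} (hA : A.Nonempty) (hAS : A ⊆ S.erase v)
    (hn : ∀ a ∈ A, ∀ b ∈ S.erase v \ A, ¬ G.Adj a b) : ∃ a ∈ A, G.Adj v a := by
  obtain ⟨a, ha, b, hb, hab⟩ := h.2 A (hAS.trans (Finset.erase_subset _ _)) hA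
    (fun e => Finset.notMem_erase v S (hAS (e ▸ hv)))
  rw [Finset.mem_sdiff] at hb
  rcases eq_or_ne b v with rfl | hbv
  · exact ⟨a, ha, hab.symm⟩
  · exact absurd hab (hn a ha b (Finset.mem_sdiff.2 ⟨Finset.mem_erase.2 ⟨hbv, hb.1⟩, hb.2⟩))

theorem insert {A : Finset V} (h : G.CutConnected A) {a w : V} (ha : a ∈ A) (hw : w ∉ A)
    (haw : G.Adj a w) : G.CutConnected (insert w A) := by
  refine ⟨Finset.insert_nonempty _ _, fun B hB hne hBA => ?_⟩
  by_cases hwB : w ∈ B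
  · have hsub : B.erase w ⊆ A := Finset.subset_insert_iff.1 hB
    rcases (B.erase w).eq_empty_or_nonempty with he | hne'
    · refine ⟨w, hwB, a, ?_, haw.symm⟩
      have : a ∉ B := fun h' => by
        have : a ∈ B.erase w := Finset.mem_erase.2 ⟨haw.ne, h'⟩
        simp [he] at this
      simp [this, ha]
    · obtain ⟨c, hc, d, hd, hcd⟩ := h.2 _ hsub hne' fun e => hBA (by
        rw [← e, Finset.insert_erase hwB])
      refine ⟨c, Finset.mem_of_mem_erase hc, d, ?_, hcd⟩
      simp only [Finset.mem_sdiff, Finset.mem_erase, Finset.mem_insert] at hd ⊢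
      refine ⟨Or.inr hd.1, fun hdB => hd.2 ⟨?_, hdB⟩⟩
      rintro rfl
      exact hw hd.1
  · have hsub : B ⊆ A := (Finset.subset_insert_iff_of_notMem hwB).1 hB
    by_cases e : B = A
    · subst e
      exact ⟨a, ha, w, by simp [hw], haw⟩
    · obtain ⟨c, hc, d, hd, hcd⟩ := h.2 B hsub hne e
      refine ⟨c, hc, d, ?_, hcd⟩
      simp only [Finset.mem_sdiff, Finset.mem_insert] at hd ⊢
      exact ⟨Or.inr hd.1, hd.2⟩

theorem singleton (v : V) : G.CutConnected {v} := by
  refine ⟨Finset.singleton_nonempty v, fun A hA hne hA' => ?_⟩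
  rcases Finset.subset_singleton_iff.1 hA with rfl | rfl
  · exact absurd hne Finset.not_nonempty_empty
  · exact absurd rfl hA'

/-- The complement of a maximal proper connected part is a single vertex. -/
theorem exists_erase {S : Finset V} (h : G.CutConnected S) (hS : 2 ≤ S.card) :
    ∃ v ∈ S, G.CutConnected (S.erase v) := by
  classical
  obtain ⟨x, hx⟩ := h.1
  obtain ⟨A, hA, hmax⟩ := Finset.exists_max_image
    (S.powerset.filter fun A => G.CutConnected A ∧ A ≠ S) Finset.card
    ⟨{x}, by
      simp only [Finset.mem_filter, Finset.mem_powerset, Finset.singleton_subset_iff]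
      refine ⟨hx, singleton x, fun e => ?_⟩
      rw [← e] at hS
      simp at hS⟩
  simp only [Finset.mem_filter, Finset.mem_powerset] at hA hmax
  obtain ⟨a, ha, w, hw, haw⟩ := h.2 A hA.1 hA.2.1.1 hA.2.2
  rw [Finset.mem_sdiff] at hw
  have hI := hA.2.1.insert ha hw.2 haw
  have hIS : Insert.insert w A = S := by
    by_contra hne
    have := hmax _ ⟨Finset.insert_subset hw.1 hA.1, hI, hne⟩
    rw [Finset.card_insert_of_notMem hw.2] at this
    omega
  refine ⟨w, hw.1, ?_⟩
  rw [← hIS, Finset.erase_insert hw.2]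
  exact hA.2.1

end CutConnected

/-- Claw-freeness in terms of adjacency: among three neighbours of a vertex two are adjacent. -/
def NoClaw (G : SimpleGraph V) : Prop :=
  ∀ v a b c, G.Adj v a → G.Adj v b → G.Adj v c → a ≠ b → a ≠ c → b ≠ c →
    G.Adj a b ∨ G.Adj a c ∨ G.Adj b c

/-- Deleting a vertex of a connected claw-free graph leaves at most two components. -/
theorem NoClaw.cutConnected_erase_or (hc : G.NoClaw) {S : Finset V} (h : G.CutConnected S)
    {v : V} (hv : v ∈ S) (hne : (S.erase v).Nonempty) :
    G.CutConnected (S.erase v) ∨ ∃ A B : Finset V, G.CutConnected A ∧ G.CutConnected B ∧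
      Disjoint A B ∧ A ∪ B = S.erase v ∧ ∀ a ∈ A, ∀ b ∈ B, ¬ G.Adj a b := by
  have three : ∀ A B D : Finset V, A.Nonempty → B.Nonempty → D.Nonempty → Disjoint A B →
      Disjoint A D → Disjoint B D → A ∪ B ∪ D = S.erase v → (∀ a ∈ A, ∀ b ∈ B, ¬ G.Adj a b) →
      (∀ a ∈ A, ∀ b ∈ D, ¬ G.Adj a b) → (∀ a ∈ B, ∀ b ∈ D, ¬ G.Adj a b) → False := by
    intro A B D hA hB hD dAB dAD dBD hU nAB nAD nBD
    obtain ⟨a, ha, hva⟩ := h.exists_adj_of_erase hv hA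
      (hU ▸ Finset.subset_union_left.trans Finset.subset_union_left) fun a ha b hb hab => by
        simp only [← hU, Finset.mem_sdiff, Finset.mem_union] at hb
        have := nAB a ha b; have := nAD a ha b
        tauto
    obtain ⟨b, hb, hvb⟩ := h.exists_adj_of_erase hv hB
      (hU ▸ Finset.subset_union_right.trans Finset.subset_union_left) fun a ha b hb hab => by
        simp only [← hU, Finset.mem_sdiff, Finset.mem_union] at hb
        have := fun hb => nAB b hb a ha hab.symm; have := nBD a ha b
        tauto
    obtain ⟨d, hd, hvd⟩ := h.exists_adj_of_erase hv hD
      (hU ▸ Finset.subset_union_right) fun a ha b hb hab => by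
        simp only [← hU, Finset.mem_sdiff, Finset.mem_union] at hb
        have := fun hb => nAD b hb a ha hab.symm; have := fun hb => nBD b hb a ha hab.symm
        tauto
    rcases hc v a b d hva hvb hvd (fun e => Finset.disjoint_left.1 dAB ha (e ▸ hb))
      (fun e => Finset.disjoint_left.1 dAD ha (e ▸ hd))
      (fun e => Finset.disjoint_left.1 dBD hb (e ▸ hd)) with h' | h' | h'
    · exact nAB a ha b hb h'
    · exact nAD a ha d hd h'
    · exact nBD b hb d hd h'
  by_cases hcon : G.CutConnected (S.erase v)
  · exact Or.inl hcon
  obtain ⟨A, B, hA, hB, hd, hU, hn⟩ := exists_split_of_not_cutConnected hne hcon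
  refine Or.inr ⟨A, B, ?_, ?_, hd, hU, hn⟩
  · by_contra hAc
    obtain ⟨A₁, A₂, h1, h2, hd', rfl, hn'⟩ := exists_split_of_not_cutConnected hA hAc
    rw [Finset.disjoint_union_left] at hd
    exact three A₁ A₂ B h1 h2 hB hd' hd.1 hd.2 hU hn'
      (fun a ha => hn a (Finset.mem_union_left _ ha))
      (fun a ha => hn a (Finset.mem_union_right _ ha))
  · by_contra hBc
    obtain ⟨B₁, B₂, h1, h2, hd', rfl, hn'⟩ := exists_split_of_not_cutConnected hB hBc
    rw [Finset.disjoint_union_right] at hd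
    exact three A B₁ B₂ hA h1 h2 hd.1 hd.2 hd' (by rw [Finset.union_assoc, hU])
      (fun a ha b hb => hn a ha b (Finset.mem_union_left _ hb))
      (fun a ha b hb => hn a ha b (Finset.mem_union_right _ hb)) hn'

/-! ### Zeros of connected claw-free graphs are simple -/

/-- The matching polynomial of a connected claw-free graph has no multiple real root. If `θ` were
a multiple root, the deletion of any vertex `v` would leave a root of multiplicity at most two, by
induction on the at most two components. All these multiplicities are one, for this
holds at a vertex that is not a cut vertex, and the property spreads along edges. Then also
`f (S - u - v) (θ) = 0` spreads from adjacent pairs to all pairs `u, v`, and summing over `v` gives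
`f' (S - u) (θ) = 0`, a contradiction. -/
theorem NoClaw.not_sq_dvd (hc : G.NoClaw) [DecidableRel G.Adj] {f : Finset V → ℝ[X]}
    (h : MatchRec G (fun _ => X) f) (θ : ℝ) {S : Finset V} (hS : G.CutConnected S) :
    ¬ (X - C θ) ^ 2 ∣ f S := by
  induction hk : S.card using Nat.strong_induction_on generalizing S with
  | _ k ih =>
    intro hd
    obtain ⟨v₀, hv₀⟩ := hS.1
    rcases Nat.lt_or_ge S.card 2 with hlt | hge
    · have : S = {v₀} := by
        refine Finset.eq_singleton_iff_unique_mem.2 ⟨hv₀, fun w hw => ?_⟩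
        exact Finset.card_le_one.1 (by omega) _ hw _ hv₀
      subst this
      rw [h.step _ v₀ hv₀] at hd
      have := ((sq_dvd_iff_eval_derivative _ _).1 hd).2
      simp [h.empty] at this
    have hsub : ∀ A ⊆ S, A ≠ S → G.CutConnected A → ¬ (X - C θ) ^ 2 ∣ f A := fun A hA hne hcon =>
      ih _ (hk ▸ Finset.card_lt_card (hA.ssubset_of_ne hne)) hcon rfl
    have herase : ∀ v ∈ S, ∀ A ⊆ S.erase v, G.CutConnected A → ¬ (X - C θ) ^ 2 ∣ f A :=
      fun v hv A hA => hsub A (hA.trans (Finset.erase_subset _ _))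
        (fun e => Finset.notMem_erase v S (hA (e ▸ hv)))
    -- each of the at most two components of `S - v` contributes at most one to the multiplicity
    have h3 : ∀ v ∈ S, ¬ (X - C θ) ^ 3 ∣ f (S.erase v) := by
      intro v hv hdvd
      have hne : (S.erase v).Nonempty := Finset.card_pos.1 (by
        rw [Finset.card_erase_of_mem hv]; omega)
      rcases hc.cutConnected_erase_or hS hv hne with hcon | ⟨A, B, hA, hB, hdis, hU, hn⟩
      · exact herase v hv _ le_rfl hcon ((pow_dvd_pow _ (by norm_num)).trans hdvd)
      · have hA2 := herase v hv A (hU ▸ Finset.subset_union_left) hA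
        have hB2 := herase v hv B (hU ▸ Finset.subset_union_right) hB
        have hA0 : f A ≠ 0 := fun e => hA2 (e ▸ dvd_zero _)
        have hB0 : f B ≠ 0 := fun e => hB2 (e ▸ dvd_zero _)
        rw [← hU, h.union A B hdis hn, ← le_rootMultiplicity_iff (mul_ne_zero hA0 hB0),
          rootMultiplicity_mul (mul_ne_zero hA0 hB0)] at hdvd
        rw [← le_rootMultiplicity_iff hA0] at hA2
        rw [← le_rootMultiplicity_iff hB0] at hB2
        omega
    obtain ⟨u, hu, hucon⟩ := hS.exists_erase hge
    have hu1 : ¬ (X - C θ) ^ 2 ∣ f (S.erase u) := herase u hu _ le_rfl hucon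
    -- an edge between the vertices of multiplicity two and those of multiplicity one is impossible
    have h1 : ∀ v ∈ S, ¬ (X - C θ) ^ 2 ∣ f (S.erase v) := by
      classical
      intro v hv hv2
      obtain ⟨a, ha, b, hb, hab⟩ := hS.2 (S.filter fun v => (X - C θ) ^ 2 ∣ f (S.erase v))
        (Finset.filter_subset _ _) ⟨v, Finset.mem_filter.2 ⟨hv, hv2⟩⟩
        (fun e => hu1 (Finset.filter_eq_self.1 e u hu))
      rw [Finset.mem_filter] at ha
      rw [Finset.mem_sdiff, Finset.mem_filter] at hb
      exact hb.2 ⟨hb.1, h.sq_dvd_erase_of_adj hd hb.1 ha.1 hab.symm ha.2 (h3 a ha.1)⟩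
    -- no edge leaves the set of all `w` that satisfy this condition
    have h0 : ∀ w ∈ S, w ≠ u → (f ((S.erase u).erase w)).eval θ = 0 := by
      classical
      intro w hw hwu
      by_contra hw0
      obtain ⟨v, hv, w', hw', hvw⟩ := hS.2
        (S.filter fun w => w ≠ u → (f ((S.erase u).erase w)).eval θ = 0)
        (Finset.filter_subset _ _) ⟨u, Finset.mem_filter.2 ⟨hu, fun h => absurd rfl h⟩⟩
        (fun e => hw0 (Finset.filter_eq_self.1 e w hw hwu))
      rw [Finset.mem_filter] at hv
      rw [Finset.mem_sdiff, Finset.mem_filter] at hw'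
      refine hw'.2 ⟨hw'.1, fun hne => ?_⟩
      rcases eq_or_ne v u with rfl | hvu
      · exact h.eval_erase_erase_eq_zero hd hu hw'.1 hvw
      · refine (mul_eq_zero.1 (h.derivative_mul_eval_eq_zero hd hu hv.1 hw'.1 hvu.symm hne.symm
          hvw.ne (hv.2 hvu) (h.eval_erase_erase_eq_zero hd hv.1 hw'.1 hvw))).resolve_left
          fun h' => ?_
        exact h1 v hv.1 ((sq_dvd_iff_eval_derivative _ _).2 ⟨h.eval_erase_eq_zero hd hv.1, h'⟩)
    refine hu1 ((sq_dvd_iff_eval_derivative _ _).2 ⟨h.eval_erase_eq_zero hd hu, ?_⟩)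
    rw [h.derivative, eval_finsetSum]
    exact Finset.sum_eq_zero fun w hw => h0 w (Finset.mem_of_mem_erase hw) (Finset.ne_of_mem_erase hw)

end SimpleGraph

namespace SimpleGraph

variable {V : Type*}

/-! ### Degrees within a vertex set -/

section Adjacency

variable (G : SimpleGraph V) [DecidableRel G.Adj]

/-- The adjacency matrix of `G` with integer entries. -/
def adjInt (u v : V) : ℤ := if G.Adj u v then 1 else 0

/-- The number of neighbours of `v` in `S`. -/
def degIn (S : Finset V) (v : V) : ℤ := ∑ w ∈ S, G.adjInt v w

variable {G}

theorem adjInt_comm (u v : V) : G.adjInt u v = G.adjInt v u := by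
  simp [adjInt, G.adj_comm]

@[simp] theorem adjInt_self (u : V) : G.adjInt u u = 0 := by simp [adjInt]

theorem adjInt_sq (u v : V) : G.adjInt u v ^ 2 = G.adjInt u v := by
  unfold adjInt; split_ifs <;> rfl

end Adjacency

variable [DecidableEq V]

/-! ### The matching polynomial satisfies the recurrence -/

section Existence

variable [Fintype V] (G : SimpleGraph V)

open Classical in
/-- The matchings of `G` all of whose edges have both ends in `S`. -/
noncomputable def matchingsIn (S : Finset V) : Finset (Finset (Sym2 V)) :=
  Finset.univ.filter fun M => G.IsEdgeMatching M ∧ ∀ e ∈ M, ∀ v ∈ e, v ∈ S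

/-- The matching polynomial of the subgraph induced by `S`, as a sum over its matchings. -/
noncomputable def inducedMatchingPolynomial (S : Finset V) : ℤ[X] :=
  ∑ M ∈ G.matchingsIn S, (-1) ^ M.card * X ^ (S.card - 2 * M.card)

variable {G}

theorem mem_matchingsIn {S : Finset V} {M : Finset (Sym2 V)} :
    M ∈ G.matchingsIn S ↔ G.IsEdgeMatching M ∧ ∀ e ∈ M, ∀ v ∈ e, v ∈ S := by
  simp [matchingsIn]

theorem two_mul_card_le_of_mem_matchingsIn {S : Finset V} {M : Finset (Sym2 V)}
    (h : M ∈ G.matchingsIn S) : 2 * M.card ≤ S.card := by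
  rw [mem_matchingsIn] at h
  have h1 : (M.biUnion Sym2.toFinset).card = ∑ e ∈ M, e.toFinset.card := by
    refine Finset.card_biUnion fun e he e' he' hne => Finset.disjoint_left.2 fun v hv hv' => ?_
    exact h.1.2 e he e' he' hne v ⟨Sym2.mem_toFinset.1 hv, Sym2.mem_toFinset.1 hv'⟩
  have h2 : ∑ e ∈ M, e.toFinset.card = ∑ e ∈ M, 2 :=
    Finset.sum_congr rfl fun e he =>
      Sym2.card_toFinset_of_not_isDiag e (G.not_isDiag_of_mem_edgeSet (h.1.1 e he))
  have h3 : M.biUnion Sym2.toFinset ⊆ S := by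
    intro v hv
    obtain ⟨e, he, hve⟩ := Finset.mem_biUnion.1 hv
    exact h.2 e he v (Sym2.mem_toFinset.1 hve)
  have h4 := Finset.card_le_card h3
  rw [h1, h2, Finset.sum_const, smul_eq_mul] at h4
  omega

theorem matchingsIn_erase (S : Finset V) (u : V) :
    G.matchingsIn (S.erase u) = (G.matchingsIn S).filter fun M => ∀ e ∈ M, u ∉ e := by
  ext M
  simp only [Finset.mem_filter, mem_matchingsIn, Finset.mem_erase]
  constructor
  · rintro ⟨h1, h2⟩
    exact ⟨⟨h1, fun e he v hv => (h2 e he v hv).2⟩, fun e he hu => (h2 e he u hu).1 rfl⟩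
  · rintro ⟨⟨h1, h2⟩, h3⟩
    exact ⟨h1, fun e he v hv => ⟨fun h => h3 e he (h ▸ hv), h2 e he v hv⟩⟩

theorem insert_mem_matchingsIn {S : Finset V} {u w : V} (hu : u ∈ S) (hw : w ∈ S)
    (ha : G.Adj u w) {M : Finset (Sym2 V)} (hM : M ∈ G.matchingsIn ((S.erase u).erase w)) :
    insert s(u, w) M ∈ G.matchingsIn S ∧ s(u, w) ∉ M := by
  rw [mem_matchingsIn] at hM ⊢
  obtain ⟨⟨h1, h2⟩, h3⟩ := hM
  have h4 : ∀ e ∈ M, ∀ v ∈ s(u, w), v ∉ e := by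
    intro e he v hv hve
    have := h3 e he v hve
    rcases Sym2.mem_iff.1 hv with rfl | rfl <;> simp at this
  refine ⟨⟨⟨?_, ?_⟩, ?_⟩, fun h => h4 _ h u (Sym2.mem_mk_left u w) (Sym2.mem_mk_left u w)⟩
  · intro e he
    rcases Finset.mem_insert.1 he with rfl | he
    · exact ha
    · exact h1 e he
  · intro e he e' he' hne v hv
    rcases Finset.mem_insert.1 he with rfl | he <;> rcases Finset.mem_insert.1 he' with rfl | he'
    · exact hne rfl
    · exact h4 e' he' v hv.1 hv.2
    · exact h4 e he v hv.2 hv.1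
    · exact h2 e he e' he' hne v hv
  · intro e he v hv
    rcases Finset.mem_insert.1 he with rfl | he
    · rcases Sym2.mem_iff.1 hv with rfl | rfl <;> assumption
    · exact Finset.mem_of_mem_erase (Finset.mem_of_mem_erase (h3 e he v hv))

theorem matchRec_inducedMatchingPolynomial [DecidableRel G.Adj] :
    MatchRec G (fun _ => X) G.inducedMatchingPolynomial where
  empty := by
    have : G.matchingsIn ∅ = {∅} := by
      ext M
      rw [Finset.mem_singleton]
      constructor
      · intro h
        have := two_mul_card_le_of_mem_matchingsIn h
        simpa using this
      · rintro rfl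
        simp [mem_matchingsIn, IsEdgeMatching]
    simp [inducedMatchingPolynomial, this]
  step S u hu := by
    have e1 : X * G.inducedMatchingPolynomial (S.erase u) =
        ∑ M ∈ (G.matchingsIn S).filter (fun M => ∀ e ∈ M, u ∉ e),
          (-1) ^ M.card * X ^ (S.card - 2 * M.card) := by
      rw [inducedMatchingPolynomial, Finset.mul_sum, ← matchingsIn_erase]
      refine Finset.sum_congr rfl fun M hM => ?_
      have h1 := two_mul_card_le_of_mem_matchingsIn hM
      rw [Finset.card_erase_of_mem hu] at h1 ⊢
      have h2 : 0 < S.card := Finset.card_pos.2 ⟨u, hu⟩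
      rw [show S.card - 2 * M.card = (S.card - 1 - 2 * M.card) + 1 by omega, pow_succ]
      ring
    have e2 : ∑ w ∈ S.erase u with G.Adj u w,
        G.inducedMatchingPolynomial ((S.erase u).erase w) =
        - ∑ M ∈ (G.matchingsIn S).filter (fun M => ¬ ∀ e ∈ M, u ∉ e),
          (-1) ^ M.card * X ^ (S.card - 2 * M.card) := by
      rw [← Finset.sum_neg_distrib]
      simp only [inducedMatchingPolynomial]
      rw [Finset.sum_sigma']
      refine Finset.sum_bij (fun z _ => insert s(u, z.1) z.2) ?_ ?_ ?_ ?_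
      · rintro ⟨w, M⟩ hz
        simp only [Finset.mem_sigma, Finset.mem_filter] at hz ⊢
        refine ⟨(insert_mem_matchingsIn hu (Finset.mem_of_mem_erase hz.1.1) hz.1.2 hz.2).1,
          fun h => h _ (Finset.mem_insert_self _ _) (Sym2.mem_mk_left u w)⟩
      · rintro ⟨w, M⟩ hz ⟨w', M'⟩ hz' heq
        simp only [Finset.mem_sigma, Finset.mem_filter] at hz hz' heq
        have hnot : ∀ {w : V} {M : Finset (Sym2 V)},
            M ∈ G.matchingsIn ((S.erase u).erase w) → ∀ e ∈ M, u ∉ e := fun hM e he hue => by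
          have := (mem_matchingsIn.1 hM).2 e he u hue
          simp at this
        have hww : w = w' := by
          have : s(u, w) ∈ insert s(u, w') M' := heq ▸ Finset.mem_insert_self _ _
          rcases Finset.mem_insert.1 this with h | h
          · exact Sym2.congr_right.1 h
          · exact absurd (Sym2.mem_mk_left u w) (hnot hz'.2 _ h)
        subst hww
        have h1 := (insert_mem_matchingsIn hu (Finset.mem_of_mem_erase hz.1.1) hz.1.2 hz.2).2
        have h2 := (insert_mem_matchingsIn hu (Finset.mem_of_mem_erase hz.1.1) hz.1.2 hz'.2).2
        have : M = M' := by
          rw [← Finset.erase_insert h1, heq, Finset.erase_insert h2]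
        rw [this]
      · intro M hM
        simp only [Finset.mem_filter, not_forall, not_not] at hM
        obtain ⟨hM, e, he, hue⟩ := hM
        obtain ⟨w, rfl⟩ := hue
        have hM' := mem_matchingsIn.1 hM
        have ha : G.Adj u w := hM'.1.1 _ he
        have hwS : w ∈ S := hM'.2 _ he w (Sym2.mem_mk_right u w)
        refine ⟨⟨w, M.erase s(u, w)⟩, ?_, Finset.insert_erase he⟩
        simp only [Finset.mem_sigma, Finset.mem_filter, Finset.mem_erase, mem_matchingsIn]
        refine ⟨⟨⟨ha.ne', hwS⟩, ha⟩, ⟨fun e' h' => hM'.1.1 e' (Finset.mem_of_mem_erase h'),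
          fun a h1 b h2 => hM'.1.2 a (Finset.mem_of_mem_erase h1) b (Finset.mem_of_mem_erase h2)⟩, fun e' h' v hv => ⟨?_, ?_, hM'.2 e' h'.2 v hv⟩⟩
        · rintro rfl
          exact hM'.1.2 e' h'.2 _ he h'.1 v ⟨hv, Sym2.mem_mk_right u v⟩
        · rintro rfl
          exact hM'.1.2 e' h'.2 _ he h'.1 v ⟨hv, Sym2.mem_mk_left v w⟩
      · rintro ⟨w, M⟩ hz
        simp only [Finset.mem_sigma, Finset.mem_filter] at hz
        have h1 := (insert_mem_matchingsIn hu (Finset.mem_of_mem_erase hz.1.1) hz.1.2 hz.2).2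
        simp only
        rw [Finset.card_insert_of_notMem h1, Finset.card_erase_of_mem hz.1.1,
          Finset.card_erase_of_mem hu, show S.card - 1 - 1 - 2 * M.card =
            S.card - 2 * (M.card + 1) by omega]
        ring
    rw [e1, e2, sub_neg_eq_add, Finset.sum_filter_add_sum_filter_not, inducedMatchingPolynomial]

theorem inducedMatchingPolynomial_univ :
    G.inducedMatchingPolynomial Finset.univ = G.matchingPolynomial := by
  classical
  rw [inducedMatchingPolynomial, matchingPolynomial, Nat.card_eq_fintype_card, Finset.card_univ]
  have hmaps : ∀ M ∈ G.matchingsIn Finset.univ,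
      M.card ∈ Finset.range (Fintype.card V / 2 + 1) := fun M hM => by
    have := two_mul_card_le_of_mem_matchingsIn hM
    rw [Finset.card_univ] at this
    rw [Finset.mem_range]; omega
  rw [← Finset.sum_fiberwise_of_maps_to hmaps]
  refine Finset.sum_congr rfl fun r _ => ?_
  have e1 : G.numMatchings r = ((G.matchingsIn Finset.univ).filter fun M => M.card = r).card := by
    rw [numMatchings, ← Set.ncard_coe_finset]
    congr 1
    ext M
    simp [mem_matchingsIn, and_comm]
  rw [Finset.sum_congr rfl (g := fun _ => (-1) ^ r * X ^ (Fintype.card V - 2 * r))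
    (fun M hM => by rw [(Finset.mem_filter.1 hM).2]), Finset.sum_const, e1]
  simp
  ring

end Existence

/-! ### The leading coefficients of the matching polynomial -/

section Coefficients

variable {G : SimpleGraph V} [DecidableRel G.Adj]

theorem degIn_erase {S : Finset V} {u : V} (hu : u ∈ S) (v : V) :
    G.degIn (S.erase u) v = G.degIn S v - G.adjInt v u := by
  rw [degIn, Finset.sum_erase_eq_sub hu, degIn]

/-- The degree sum after the deletion of two vertices. -/
theorem sum_degIn_erase_erase {S : Finset V} {u w : V} (hu : u ∈ S) (hw : w ∈ S) (huw : u ≠ w) :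
    ∑ v ∈ (S.erase u).erase w, G.degIn ((S.erase u).erase w) v =
      ∑ v ∈ S, G.degIn S v - 2 * G.degIn S u - 2 * G.degIn S w + 2 * G.adjInt u w := by
  have hw' : w ∈ S.erase u := Finset.mem_erase.2 ⟨huw.symm, hw⟩
  have one : ∀ {S : Finset V} {u : V}, u ∈ S → ∑ v ∈ S.erase u, G.degIn (S.erase u) v =
      ∑ v ∈ S, G.degIn S v - 2 * G.degIn S u := by
    intro S u hu
    rw [Finset.sum_erase_eq_sub hu, Finset.sum_congr rfl fun v _ => degIn_erase hu v,
      Finset.sum_sub_distrib, degIn_erase hu, adjInt_self]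
    have : ∑ v ∈ S, G.adjInt v u = G.degIn S u :=
      Finset.sum_congr rfl fun v _ => adjInt_comm v u
    rw [this]; ring
  rw [one hw', one hu, degIn_erase hu, adjInt_comm w u]
  ring

namespace MatchRec

variable {f : Finset V → ℤ[X]}

theorem coeff_of_card_le (h : MatchRec G (fun _ => X) f) (S : Finset V) {k : ℕ}
    (hk : S.card ≤ k) : (f S).coeff k = if k = S.card then 1 else 0 := by
  induction hc : S.card using Nat.strong_induction_on generalizing S k with
  | _ c ih =>
    rcases S.eq_empty_or_nonempty with rfl | ⟨u, hu⟩
    · simp only [Finset.card_empty] at hc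
      simp [h.empty, ← hc, coeff_one]
    have hpos : 0 < S.card := Finset.card_pos.2 ⟨u, hu⟩
    have hcu := Finset.card_erase_of_mem hu
    obtain ⟨k, rfl⟩ : ∃ j, k = j + 1 := ⟨k - 1, by omega⟩
    rw [h.step S u hu, coeff_sub, coeff_X_mul, ih _ (by omega) (S.erase u) (by omega) rfl,
      finsetSum_coeff, Finset.sum_eq_zero, sub_zero]
    · congr 1
      rw [eq_iff_iff]
      omega
    · intro w hw
      have hcw := Finset.card_erase_of_mem (Finset.mem_filter.1 hw).1
      rw [ih _ (by omega) ((S.erase u).erase w) (by omega) rfl, if_neg (by omega)]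

theorem monic (h : MatchRec G (fun _ => X) f) (S : Finset V) : (f S).Monic :=
  monic_of_natDegree_le_of_coeff_eq_one S.card
    (natDegree_le_iff_coeff_eq_zero.2 fun k hk => by
      rw [h.coeff_of_card_le S hk.le, if_neg hk.ne'])
    (by rw [h.coeff_of_card_le S le_rfl, if_pos rfl])

theorem natDegree (h : MatchRec G (fun _ => X) f) (S : Finset V) : (f S).natDegree = S.card :=
  natDegree_eq_of_le_of_coeff_ne_zero
    (natDegree_le_iff_coeff_eq_zero.2 fun k hk => by
      rw [h.coeff_of_card_le S hk.le, if_neg hk.ne'])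
    (by rw [h.coeff_of_card_le S le_rfl, if_pos rfl]; exact one_ne_zero)

/-- The exponents of `f S` have the parity of the order of `S`. -/
theorem eval_neg (h : MatchRec G (fun _ => X) f) (S : Finset V) (z : ℤ) :
    (f S).eval (-z) = (-1) ^ S.card * (f S).eval z := by
  induction hc : S.card using Nat.strong_induction_on generalizing S with
  | _ c ih =>
    rcases S.eq_empty_or_nonempty with rfl | ⟨u, hu⟩
    · simp only [Finset.card_empty] at hc
      simp [h.empty, ← hc]
    have hpos : 0 < S.card := Finset.card_pos.2 ⟨u, hu⟩
    have hcu := Finset.card_erase_of_mem hu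
    have e1 := ih _ (by omega) (S.erase u) rfl
    rw [h.step S u hu]
    simp only [eval_sub, eval_mul, eval_X, eval_finsetSum]
    rw [e1, mul_sub, Finset.mul_sum]
    congr 1
    · rw [show c = (S.erase u).card + 1 by omega, pow_succ]; ring
    · refine Finset.sum_congr rfl fun w hw => ?_
      have hwu := (Finset.mem_filter.1 hw).1
      have hcw := Finset.card_erase_of_mem hwu
      have := Finset.card_pos.2 ⟨w, hwu⟩
      rw [ih _ (by omega) ((S.erase u).erase w) rfl,
        show c = ((S.erase u).erase w).card + 2 by omega, pow_add]
      simp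

/-- Comparing coefficients in `∑ f (S - u - w) = x f' S - |S| f S`, the sum being over the ordered
pairs of adjacent vertices. -/
theorem sum_coeff (h : MatchRec G (fun _ => X) f) (S : Finset V) (k : ℕ) :
    ∑ u ∈ S, ∑ w ∈ S, G.adjInt u w * (f ((S.erase u).erase w)).coeff k =
      (k - S.card) * (f S).coeff k := by
  have e1 := congrArg (fun p => p.coeff k) (h.sum_adj S)
  rw [← Finset.mul_sum, ← h.derivative, coeff_sub, coeff_natCast_mul] at e1
  have e2 : (X * Polynomial.derivative (f S)).coeff k = k * (f S).coeff k := by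
    rcases k with _ | k
    · simp
    · rw [coeff_X_mul, coeff_derivative]; push_cast; ring
  rw [e2] at e1
  rw [sub_mul, ← e1, finsetSum_coeff]
  refine Finset.sum_congr rfl fun u hu => ?_
  rw [finsetSum_coeff, Finset.sum_filter, ← Finset.add_sum_erase S _ hu, adjInt_self, zero_mul,
    zero_add]
  refine Finset.sum_congr rfl fun w _ => ?_
  simp [adjInt]

theorem card_erase_erase {S : Finset V} {u w : V} (hu : u ∈ S) (hw : w ∈ S) (huw : u ≠ w) :
    ((S.erase u).erase w).card + 2 = S.card := by
  have h1 := Finset.card_erase_add_one hu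
  have h2 := Finset.card_erase_add_one (Finset.mem_erase.2 ⟨huw.symm, hw⟩)
  omega

/-- The second coefficient counts the edges, each twice in the degree sum. -/
theorem coeff_add_two (h : MatchRec G (fun _ => X) f) {S : Finset V} {k : ℕ}
    (hk : k + 2 = S.card) : 2 * (f S).coeff k = - ∑ v ∈ S, G.degIn S v := by
  have e1 := h.sum_coeff S k
  have e2 : ∀ u ∈ S, ∀ w ∈ S,
      G.adjInt u w * (f ((S.erase u).erase w)).coeff k = G.adjInt u w := by
    intro u hu w hw
    rcases eq_or_ne u w with rfl | huw
    · simp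
    · have := card_erase_erase hu hw huw
      rw [h.coeff_of_card_le _ (by omega), if_pos (by omega), mul_one]
  rw [Finset.sum_congr rfl fun u hu => Finset.sum_congr rfl (e2 u hu)] at e1
  simp only [degIn]
  rw [e1, ← hk]
  push_cast
  ring

/-- The third coefficient counts the pairs of disjoint edges, which are determined by the degree
sum and the sum of the squared degrees. The edges disjoint from a given edge are counted by the
second coefficient of the graph without its two ends. -/
theorem coeff_add_four (h : MatchRec G (fun _ => X) f) {S : Finset V} {k : ℕ}
    (hk : k + 4 = S.card) : 8 * (f S).coeff k =
      (∑ v ∈ S, G.degIn S v) ^ 2 + 2 * ∑ v ∈ S, G.degIn S v - 4 * ∑ v ∈ S, G.degIn S v ^ 2 := by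
  have e1 := h.sum_coeff S k
  set D := ∑ v ∈ S, G.degIn S v with hD
  have e2 : ∀ u ∈ S, ∀ w ∈ S,
      2 * (G.adjInt u w * (f ((S.erase u).erase w)).coeff k) =
        - ((D + 2) * G.adjInt u w) + 2 * G.degIn S u * G.adjInt u w +
          2 * (G.adjInt u w * G.degIn S w) := by
    intro u hu w hw
    rcases eq_or_ne u w with rfl | huw
    · simp
    · have := card_erase_erase hu hw huw
      have h2 := h.coeff_add_two (S := (S.erase u).erase w) (k := k) (by omega)
      rw [sum_degIn_erase_erase hu hw huw, ← hD] at h2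
      have h3 := adjInt_sq (G := G) u w
      linear_combination G.adjInt u w * h2 - 2 * h3
  have e3 : 2 * ((k - S.card) * (f S).coeff k) = - (D + 2) * D + 4 * ∑ v ∈ S, G.degIn S v ^ 2 := by
    rw [← e1, Finset.mul_sum]
    have : ∀ u ∈ S, 2 * ∑ w ∈ S, G.adjInt u w * (f ((S.erase u).erase w)).coeff k =
        - ((D + 2) * G.degIn S u) + 2 * G.degIn S u ^ 2 +
          ∑ w ∈ S, 2 * (G.adjInt u w * G.degIn S w) := by
      intro u hu
      rw [Finset.mul_sum, Finset.sum_congr rfl (e2 u hu), Finset.sum_add_distrib,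
        Finset.sum_add_distrib, Finset.sum_neg_distrib, ← Finset.mul_sum, ← Finset.mul_sum, ← degIn]
      ring
    rw [Finset.sum_congr rfl this, Finset.sum_add_distrib, Finset.sum_add_distrib,
      Finset.sum_neg_distrib, ← Finset.mul_sum, ← Finset.mul_sum, Finset.sum_comm]
    have : ∀ w ∈ S, ∑ u ∈ S, 2 * (G.adjInt u w * G.degIn S w) = 2 * G.degIn S w ^ 2 := by
      intro w _
      rw [← Finset.mul_sum, ← Finset.sum_mul, Finset.sum_congr rfl fun u _ => adjInt_comm u w,
        ← degIn]
      ring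
    rw [Finset.sum_congr rfl this, ← Finset.mul_sum]
    ring
  rw [← hk] at e3
  push_cast at e3
  linarith

end MatchRec

end Coefficients

end SimpleGraph

namespace SimpleGraph

/-! ### Factorization over the integers -/

/-- A monic integer polynomial whose complex zeros are integers without multiple integer zeros is
the product of the linear factors of its distinct integer zeros. -/
theorem eq_prod_of_complex_roots_int {p : ℤ[X]} (hp : p.Monic)
    (hint : ∀ z : ℂ, aeval z p = 0 → ∃ k : ℤ, z = (k : ℂ))
    (hsimple : ∀ k : ℤ, ¬ (X - C k) ^ 2 ∣ p) : p = ∏ k ∈ p.roots.toFinset, (X - C k) := by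
  have hnodup : p.roots.Nodup := by
    rw [Multiset.nodup_iff_count_le_one]
    intro k
    rw [count_roots]
    by_contra hk
    exact hsimple k ((le_rootMultiplicity_iff hp.ne_zero).1 (by omega))
  obtain ⟨q, hq, -, hq0⟩ := exists_prod_multiset_X_sub_C_mul p
  have hmon : q.Monic :=
    (monic_multisetProd_X_sub_C p.roots).of_mul_monic_left (by rw [hq]; exact hp)
  have hq1 : q = 1 := by
    by_contra hne
    have hdeg : (q.map (Int.castRingHom ℂ)).degree ≠ 0 := by
      rw [hmon.degree_map]
      intro h0
      exact hne (hmon.natDegree_eq_zero.1 (natDegree_eq_zero_iff_degree_le_zero.2 h0.le))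
    obtain ⟨z, hz⟩ := IsAlgClosed.exists_root _ hdeg
    have hz' : aeval z q = 0 := by
      rw [aeval_def, ← eval_map]
      exact hz
    obtain ⟨k, rfl⟩ := hint z (by rw [← hq, map_mul, hz', mul_zero])
    have hk : q.eval k = 0 := by
      have h1 : aeval ((k : ℤ) : ℂ) q = ((q.eval k : ℤ) : ℂ) := by
        have := aeval_algebraMap_apply_eq_algebraMap_eval (A := ℂ) k q
        simpa using this
      rw [h1] at hz'
      exact_mod_cast hz'
    have : k ∈ q.roots := (mem_roots hmon.ne_zero).2 hk
    rw [hq0] at this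
    simp at this
  rw [hq1, mul_one] at hq
  rw [Finset.prod_eq_multiset_prod, Multiset.toFinset_val, hnodup.dedup, hq]

/-- A finite set of integers symmetric about zero consists of pairs `a, -a` and possibly zero. -/
theorem exists_prod_eq_of_neg_mem {Z : Finset ℤ} (hZ : ∀ z ∈ Z, -z ∈ Z) :
    ∃ (T : Finset ℤ) (ε : ℕ), ε ≤ 1 ∧ (∀ a ∈ T, 0 < a) ∧ Z.card = 2 * T.card + ε ∧
      ∏ z ∈ Z, (X - C z) = X ^ ε * ∏ a ∈ T, (X ^ 2 - C (a ^ 2) : ℤ[X]) := by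
  set T := Z.filter (0 < ·) with hT
  set E := Z.filter (0 = ·) with hE
  have hpos : ∀ a ∈ T, 0 < a := fun a ha => (Finset.mem_filter.1 ha).2
  have hU : Z = (T ∪ T.image (-·)) ∪ E := by
    ext z
    simp only [hT, hE, Finset.mem_union, Finset.mem_filter, Finset.mem_image]
    constructor
    · intro hz
      rcases lt_trichotomy 0 z with h | h | h
      · exact Or.inl (Or.inl ⟨hz, h⟩)
      · exact Or.inr ⟨hz, h⟩
      · exact Or.inl (Or.inr ⟨-z, ⟨hZ z hz, by omega⟩, by simp⟩)
    · rintro ((h | ⟨a, h, rfl⟩) | h)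
      · exact h.1
      · exact hZ a h.1
      · exact h.1
  have hd1 : Disjoint T (T.image (-·)) := by
    refine Finset.disjoint_left.2 fun z hz hz' => ?_
    obtain ⟨a, ha, rfl⟩ := Finset.mem_image.1 hz'
    have := hpos a ha; have := hpos _ hz
    omega
  have hd2 : Disjoint (T ∪ T.image (-·)) E := by
    refine Finset.disjoint_left.2 fun z hz hz' => ?_
    have h0 := (Finset.mem_filter.1 hz').2
    rcases Finset.mem_union.1 hz with hz | hz
    · exact (hpos z hz).ne h0
    · obtain ⟨a, ha, rfl⟩ := Finset.mem_image.1 hz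
      have := hpos a ha
      omega
  have hE1 : E.card ≤ 1 := Finset.card_le_one.2 fun a ha b hb =>
    (Finset.mem_filter.1 ha).2.symm.trans (Finset.mem_filter.1 hb).2
  refine ⟨T, E.card, hE1, hpos, ?_, ?_⟩
  · conv_lhs => rw [hU]
    rw [Finset.card_union_of_disjoint hd2, Finset.card_union_of_disjoint hd1,
      Finset.card_image_of_injective _ neg_injective]
    ring
  · conv_lhs => rw [hU]
    rw [Finset.prod_union hd2, Finset.prod_union hd1, Finset.prod_image (neg_injective.injOn),
      ← Finset.prod_mul_distrib, mul_comm]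
    congr 1
    · rw [Finset.prod_congr rfl (g := fun _ => (X : ℤ[X])), Finset.prod_const]
      intro z hz
      rw [← (Finset.mem_filter.1 hz).2]
      simp
    · refine Finset.prod_congr rfl fun a _ => ?_
      simp only [map_neg, map_pow]
      ring

/-- The first coefficients of `∏ (X - a)`; the factors `X` shift the indices so that none of them
is negative. -/
theorem coeff_prod_X_sub_C (T : Finset ℤ) (b : ℤ → ℤ) :
    (∏ a ∈ T, (X - C (b a))).coeff T.card = 1 ∧
    (X * ∏ a ∈ T, (X - C (b a))).coeff T.card = - ∑ a ∈ T, b a ∧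
    2 * (X * (X * ∏ a ∈ T, (X - C (b a)))).coeff T.card =
      (∑ a ∈ T, b a) ^ 2 - ∑ a ∈ T, b a ^ 2 := by
  classical
  induction T using Finset.induction_on with
  | empty => simp
  | insert c T hc ih =>
    obtain ⟨h1, h2, h3⟩ := ih
    rw [Finset.prod_insert hc, Finset.sum_insert hc, Finset.sum_insert hc,
      Finset.card_insert_of_notMem hc]
    set q := ∏ a ∈ T, (X - C (b a)) with hq
    have h0 : q.coeff (T.card + 1) = 0 := by
      apply coeff_eq_zero_of_natDegree_lt
      rw [hq, natDegree_finsetProd_X_sub_C_eq_card]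
      omega
    refine ⟨?_, ?_, ?_⟩
    · rw [sub_mul, coeff_sub, coeff_X_mul, coeff_C_mul, h0, h1]; ring
    · rw [coeff_X_mul, sub_mul, coeff_sub, coeff_C_mul, h2, h1]; ring
    · rw [coeff_X_mul, show X * ((X - C (b c)) * q) = X * (X * q) - C (b c) * (X * q) by ring,
        coeff_sub, coeff_C_mul, h2]
      linear_combination h3

theorem coeff_pow_mul_prod (T : Finset ℤ) (ε j : ℕ) :
    (X ^ ε * ∏ a ∈ T, (X ^ 2 - C (a ^ 2) : ℤ[X])).coeff (2 * j + ε) =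
      (∏ a ∈ T, (X - C (a ^ 2))).coeff j := by
  have : ∏ a ∈ T, (X ^ 2 - C (a ^ 2) : ℤ[X]) = expand ℤ 2 (∏ a ∈ T, (X - C (a ^ 2))) := by
    rw [map_prod]
    refine Finset.prod_congr rfl fun a _ => ?_
    rw [map_sub, expand_X, expand_C]
  rw [coeff_X_pow_mul, this, mul_comm 2 j, coeff_expand_mul (by norm_num)]

/-! ### Zeros of matching integral claw-free graphs -/

variable {V : Type*} {G : SimpleGraph V}

theorem Connected.cutConnected_univ [Fintype V] [DecidableEq V] (h : G.Connected) :
    G.CutConnected Finset.univ := by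
  obtain ⟨v⟩ := h.nonempty
  refine ⟨⟨v, Finset.mem_univ v⟩, fun A _ ⟨a, ha⟩ hA' => ?_⟩
  obtain ⟨b, hb⟩ : ∃ b, b ∉ A := by
    by_contra hall
    push Not at hall
    exact hA' (Finset.eq_univ_of_forall hall)
  obtain ⟨w⟩ := h.preconnected a b
  obtain ⟨d, hd, h1, h2⟩ := w.exists_boundary_dart (A : Set V) (by simpa using ha) (by simpa using hb)
  exact ⟨d.fst, by simpa using h1, d.snd, by simpa using h2, d.adj⟩

theorem IsClawFree.noClaw (h : G.IsClawFree) : G.NoClaw := by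
  intro v a b c hva hvb hvc hab hac hbc
  by_contra hno
  push Not at hno
  obtain ⟨nab, nac, nbc⟩ := hno
  have inj : Function.Injective (Sum.elim (fun _ : Fin 1 => v) ![a, b, c]) := by
    rintro (i | i) (j | j) hij <;> fin_cases i <;> fin_cases j <;>
      simp_all [hva.ne, hvb.ne, hvc.ne, hva.ne', hvb.ne', hvc.ne', hab.symm, hac.symm, hbc.symm]
  refine h ⟨⟨⟨Sum.elim (fun _ => v) ![a, b, c], inj⟩, ?_⟩⟩
  rintro (i | i) (j | j) <;> fin_cases i <;> fin_cases j <;>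
    simp [hva, hvb, hvc, hva.symm, hvb.symm, hvc.symm, nab, nac, nbc, G.adj_comm b a,
      G.adj_comm c a, G.adj_comm c b]

/-- The matching polynomial of a connected matching integral claw-free graph has distinct zeros,
which come in pairs `a, -a`. -/
theorem exists_matchingPolynomial_eq_prod [Fintype V] (hconn : G.Connected)
    (hint : G.IsMatchingIntegral) (hclaw : G.IsClawFree) :
    ∃ (T : Finset ℤ) (ε : ℕ), ε ≤ 1 ∧ (∀ a ∈ T, 0 < a) ∧ Fintype.card V = 2 * T.card + ε ∧
      G.matchingPolynomial = X ^ ε * ∏ a ∈ T, (X ^ 2 - C (a ^ 2)) := by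
  classical
  have hrec := matchRec_inducedMatchingPolynomial (G := G)
  have hmon := hrec.monic Finset.univ
  have hdeg := hrec.natDegree Finset.univ
  have hneg := hrec.eval_neg Finset.univ
  rw [inducedMatchingPolynomial_univ] at hmon hdeg hneg
  have hsimple : ∀ k : ℤ, ¬ (X - C k) ^ 2 ∣ G.matchingPolynomial := by
    intro k hk
    have h1 := (hrec.map (mapRingHom (Int.castRingHom ℝ)))
    simp only [coe_mapRingHom, map_X] at h1
    refine hclaw.noClaw.not_sq_dvd h1 k hconn.cutConnected_univ ?_
    rw [inducedMatchingPolynomial_univ]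
    have := Polynomial.map_dvd (Int.castRingHom ℝ) hk
    simpa using this
  have hprod := eq_prod_of_complex_roots_int hmon hint hsimple
  obtain ⟨T, ε, h1, h2, h3, h4⟩ := exists_prod_eq_of_neg_mem
    (Z := G.matchingPolynomial.roots.toFinset) (fun z hz => by
      rw [Multiset.mem_toFinset, mem_roots hmon.ne_zero, IsRoot] at hz ⊢
      rw [hneg, hz, mul_zero])
  refine ⟨T, ε, h1, h2, ?_, hprod.trans h4⟩
  rw [← h3, ← Finset.card_univ, ← hdeg]
  conv_lhs => rw [hprod]
  exact natDegree_finsetProd_X_sub_C_eq_card _ _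

end SimpleGraph

namespace SimpleGraph

variable {V : Type*} {G : SimpleGraph V}

/-! ### Degree sums in terms of the zeros -/

section Degrees

variable [Fintype V] [DecidableRel G.Adj]

theorem degIn_univ (v : V) : G.degIn Finset.univ v = G.degree v := by
  simp [degIn, adjInt, ← G.card_neighborFinset_eq_degree, G.neighborFinset_eq_filter]

theorem degIn_univ_nonneg (v : V) : 0 ≤ G.degIn Finset.univ v := by
  rw [degIn_univ]; positivity

theorem degIn_univ_le (v : V) : G.degIn Finset.univ v ≤ Fintype.card V - 1 := by
  rw [degIn_univ]
  have := G.degree_lt_card_verts v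
  omega

theorem Connected.one_le_degIn (h : G.Connected) (hV : 2 ≤ Fintype.card V) (v : V) :
    1 ≤ G.degIn Finset.univ v := by
  have : Nontrivial V := Fintype.one_lt_card_iff_nontrivial.1 hV
  rw [degIn_univ]
  exact_mod_cast h.preconnected.degree_pos_of_nontrivial v

end Degrees

section Spectrum

variable [Fintype V] [DecidableEq V] [DecidableRel G.Adj] {T : Finset ℤ} {ε : ℕ}

/-- The number of edges is the sum of the squares of the positive zeros. -/
theorem sum_degIn_eq (hV : Fintype.card V = 2 * T.card + ε) (hT : 1 ≤ T.card)
    (hμ : G.matchingPolynomial = X ^ ε * ∏ a ∈ T, (X ^ 2 - C (a ^ 2))) :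
    ∑ v, G.degIn Finset.univ v = 2 * ∑ a ∈ T, a ^ 2 := by
  have hrec := matchRec_inducedMatchingPolynomial (G := G)
  obtain ⟨j, hj⟩ : ∃ j, T.card = j + 1 := ⟨T.card - 1, by omega⟩
  have h1 := hrec.coeff_add_two (S := Finset.univ) (k := 2 * j + ε)
    (by rw [Finset.card_univ]; omega)
  rw [inducedMatchingPolynomial_univ, hμ, coeff_pow_mul_prod] at h1
  have h2 := (coeff_prod_X_sub_C T (fun a => a ^ 2)).2.1
  rw [hj, coeff_X_mul] at h2
  linarith

theorem sum_degIn_sq_eq (hV : Fintype.card V = 2 * T.card + ε) (hT : 2 ≤ T.card)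
    (hμ : G.matchingPolynomial = X ^ ε * ∏ a ∈ T, (X ^ 2 - C (a ^ 2))) :
    ∑ v, G.degIn Finset.univ v ^ 2 = ∑ a ∈ T, a ^ 2 + ∑ a ∈ T, (a ^ 2) ^ 2 := by
  have hrec := matchRec_inducedMatchingPolynomial (G := G)
  obtain ⟨j, hj⟩ : ∃ j, T.card = j + 2 := ⟨T.card - 2, by omega⟩
  have h1 := hrec.coeff_add_four (S := Finset.univ) (k := 2 * j + ε)
    (by rw [Finset.card_univ]; omega)
  rw [inducedMatchingPolynomial_univ, hμ, coeff_pow_mul_prod, sum_degIn_eq hV (by omega) hμ] at h1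
  have h2 := (coeff_prod_X_sub_C T (fun a => a ^ 2)).2.2
  rw [hj, coeff_X_mul, coeff_X_mul] at h2
  linarith

end Spectrum

/-! ### The possible sets of zeros -/

/-- A set of `m` positive integers has a sum of squares of at least `1 ^ 2 + ⋯ + m ^ 2`. -/
theorem card_mul_le_sum_sq {T : Finset ℤ} (hT : ∀ a ∈ T, 0 < a) :
    (T.card : ℤ) * (T.card + 1) * (2 * T.card + 1) ≤ 6 * ∑ a ∈ T, a ^ 2 := by
  classical
  induction T using Finset.induction_on_max with
  | empty => simp
  | insert c T hc ih =>
    have hcT : c ∉ T := fun h => lt_irrefl _ (hc c h)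
    have h1 := ih fun a ha => hT a (Finset.mem_insert_of_mem ha)
    have h2 : (T.card : ℤ) + 1 ≤ c := by
      have : insert c T ⊆ Finset.Icc 1 c := by
        intro a ha
        refine Finset.mem_Icc.2 ⟨hT a ha, ?_⟩
        rcases Finset.mem_insert.1 ha with rfl | h
        · exact le_rfl
        · exact (hc a h).le
      have := Finset.card_le_card this
      rw [Finset.card_insert_of_notMem hcT, Int.card_Icc] at this
      have := hT c (Finset.mem_insert_self _ _)
      omega
    rw [Finset.sum_insert hcT, Finset.card_insert_of_notMem hcT]
    push_cast
    nlinarith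

/-- The sets of zeros compatible with the number of edges and the degrees of a graph: the number
of edges is `∑ a ^ 2`, and the sum of the squares of the degrees is `∑ a ^ 2 + ∑ a ^ 4`. -/
theorem eq_of_sum_sq_le {T : Finset ℤ} (hT : ∀ a ∈ T, 0 < a) (h2 : 2 ≤ T.card) {ε : ℕ}
    (hε : ε ≤ 1)
    (h3 : 2 * ∑ a ∈ T, a ^ 2 ≤ (2 * T.card + ε : ℤ) * (2 * T.card + ε - 1))
    (h4 : (2 * ∑ a ∈ T, a ^ 2) ^ 2 ≤
      (2 * T.card + ε : ℤ) * (∑ a ∈ T, a ^ 2 + ∑ a ∈ T, (a ^ 2) ^ 2))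
    (h5 : ∑ a ∈ T, a ^ 2 + ∑ a ∈ T, (a ^ 2) ^ 2 ≤
      (2 * T.card + ε - 1 : ℤ) * (2 * ∑ a ∈ T, a ^ 2)) :
    ε = 1 ∧ (T = {1, 2} ∨ T = {1, 2, 3}) := by
  have h6 := card_mul_le_sum_sq hT
  have hε' : (ε : ℤ) ≤ 1 := by exact_mod_cast hε
  have hε0 : (0 : ℤ) ≤ ε := by positivity
  have h7 : (T.card : ℤ) ≤ 5 := by
    have h2' : (2 : ℤ) ≤ T.card := by exact_mod_cast h2
    have h8 : (2 * T.card + ε : ℤ) * (2 * T.card + ε - 1) ≤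
        (2 * T.card + 1 : ℤ) * (2 * T.card) := by nlinarith
    by_contra! h9
    have h10 : (0 : ℤ) < (2 * T.card + 1) * T.card * (T.card - 5) := by
      refine mul_pos (mul_pos ?_ ?_) ?_ <;> omega
    nlinarith
  have h8 : ∑ a ∈ T, a ^ 2 ≤ 55 := by nlinarith
  have h9 : T ∈ (Finset.Icc (1 : ℤ) 7).powerset := by
    refine Finset.mem_powerset.2 fun a ha => Finset.mem_Icc.2 ⟨hT a ha, ?_⟩
    have := (Finset.single_le_sum (f := fun a : ℤ => a ^ 2) (fun b _ => sq_nonneg b) ha).trans h8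
    nlinarith
  -- at most five numbers with sum of squares at most `55`, hence all at most `7`
  have key : ∀ T ∈ (Finset.Icc (1 : ℤ) 7).powerset, ∀ ε ∈ Finset.range 2, 2 ≤ T.card →
      2 * ∑ a ∈ T, a ^ 2 ≤ (2 * T.card + ε : ℤ) * (2 * T.card + ε - 1) →
      (2 * ∑ a ∈ T, a ^ 2) ^ 2 ≤
        (2 * T.card + ε : ℤ) * (∑ a ∈ T, a ^ 2 + ∑ a ∈ T, (a ^ 2) ^ 2) →
      ∑ a ∈ T, a ^ 2 + ∑ a ∈ T, (a ^ 2) ^ 2 ≤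
        (2 * T.card + ε - 1 : ℤ) * (2 * ∑ a ∈ T, a ^ 2) →
      ε = 1 ∧ (T = {1, 2} ∨ T = {1, 2, 3}) := by
    decide +kernel
  exact key T h9 ε (Finset.mem_range.2 (by omega)) h2 h3 h4 h5

/-! ### Graphs of order 7 with zeros 0, ±1, ±2, ±3 -/

section Order7

variable [Fintype V] [DecidableEq V] [DecidableRel G.Adj]

/-- In a claw-free 4-regular graph of order 7 there is no independent set of size three: each of
its vertices would be adjacent to all four vertices outside. -/
theorem NoClaw.adj_or_of_card_eq_seven (hc : G.NoClaw) (hV : Fintype.card V = 7)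
    (hd : ∀ v, G.degree v = 4) {x y z : V} (hxy : x ≠ y) (hxz : x ≠ z) (hyz : y ≠ z) :
    G.Adj x y ∨ G.Adj x z ∨ G.Adj y z := by
  by_contra hno
  push Not at hno
  obtain ⟨h1, h2, h3⟩ := hno
  have h3c : ({x, y, z} : Finset V).card = 3 := Finset.card_eq_three.2 ⟨x, y, z, hxy, hxz, hyz, rfl⟩
  have hc4 : ({x, y, z} : Finset V)ᶜ.card = 4 := by rw [Finset.card_compl, hV, h3c]
  have hN : ∀ u ∈ ({x, y, z} : Finset V), G.neighborFinset u = ({x, y, z} : Finset V)ᶜ := by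
    intro u hu
    refine Finset.eq_of_subset_of_card_le (fun v hv => ?_)
      (by rw [hc4, G.card_neighborFinset_eq_degree, hd])
    rw [mem_neighborFinset] at hv
    simp only [Finset.mem_compl, Finset.mem_insert, Finset.mem_singleton] at hu ⊢
    rintro (rfl | rfl | rfl) <;> rcases hu with rfl | rfl | rfl <;>
      simp_all [G.adj_comm]
  obtain ⟨v, hv⟩ : ({x, y, z} : Finset V)ᶜ.Nonempty := Finset.card_pos.1 (by omega)
  have hadj : ∀ u ∈ ({x, y, z} : Finset V), G.Adj v u := fun u hu => by
    rw [← hN u hu, mem_neighborFinset] at hv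
    exact hv.symm
  have := hc v x y z (hadj x (by simp)) (hadj y (by simp)) (hadj z (by simp)) hxy hxz hyz
  tauto

/-- Let `t` be the number of triangles of a 4-regular graph of order 7. Its number of matchings of
size three is `42 - t`. In the claw-free case two non-adjacent vertices have exactly three common
neighbours, so that `t = 7`, and the number of matchings is not `36`. -/
theorem NoClaw.coeff_one_ne (hc : G.NoClaw) (hV : Fintype.card V = 7)
    (hd : ∀ v, G.degIn Finset.univ v = 4) : G.matchingPolynomial.coeff 1 ≠ -36 := by
  intro hcoeff
  have hrec := matchRec_inducedMatchingPolynomial (G := G)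
  have hsum := hrec.sum_coeff Finset.univ 1
  rw [inducedMatchingPolynomial_univ, hcoeff, Finset.card_univ, hV] at hsum
  set t : V → V → ℤ := fun u w => ∑ v, G.adjInt v u * G.adjInt v w with ht
  have hdeg : ∀ u, ∑ v, G.adjInt v u = 4 := fun u => by
    rw [← hd u, degIn]
    exact Finset.sum_congr rfl fun v _ => adjInt_comm v u
  have hone : ∑ _v : V, (1 : ℤ) = 7 := by simp [hV]
  -- for an edge `uw` with `t u w` common neighbours, `9 - t u w` pairs of disjoint edges avoid it
  have h1 : ∀ u w, G.adjInt u w *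
      (G.inducedMatchingPolynomial ((Finset.univ.erase u).erase w)).coeff 1 =
        9 * G.adjInt u w - G.adjInt u w * t u w := by
    intro u w
    by_cases ha : G.Adj u w
    · have huw := ha.ne
      have hw' : w ∈ Finset.univ.erase u := Finset.mem_erase.2 ⟨huw.symm, Finset.mem_univ w⟩
      have hau : G.adjInt u w = 1 := by simp [adjInt, ha]
      have haw : G.adjInt w u = 1 := by rw [adjInt_comm, hau]
      have h2 := hrec.coeff_add_four (S := (Finset.univ.erase u).erase w) (k := 1) (by
        have := MatchRec.card_erase_erase (Finset.mem_univ u) (Finset.mem_univ w) huw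
        rw [Finset.card_univ, hV] at this
        omega)
      have h3 : ∑ v ∈ (Finset.univ.erase u).erase w,
          G.degIn ((Finset.univ.erase u).erase w) v ^ 2 = 38 + 2 * t u w := by
        have h4 : ∀ v, G.degIn ((Finset.univ.erase u).erase w) v ^ 2 =
            16 - 7 * G.adjInt v u - 7 * G.adjInt v w + 2 * (G.adjInt v u * G.adjInt v w) := by
          intro v
          rw [degIn_erase hw', degIn_erase (Finset.mem_univ u), hd]
          linear_combination adjInt_sq (G := G) v u + adjInt_sq (G := G) v w
        rw [Finset.sum_erase_eq_sub hw', Finset.sum_erase_eq_sub (Finset.mem_univ u)]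
        simp only [h4]
        rw [Finset.sum_add_distrib, Finset.sum_sub_distrib, Finset.sum_sub_distrib,
          ← Finset.mul_sum, ← Finset.mul_sum, ← Finset.mul_sum, hdeg, hdeg,
          adjInt_self, adjInt_self, hau, haw]
        have : ∑ _v : V, (16 : ℤ) = 112 := by simp [hV]
        rw [this, ht]
        ring
      rw [h3, sum_degIn_erase_erase (Finset.mem_univ u) (Finset.mem_univ w) huw, hau, hd, hd] at h2
      have : ∑ v, G.degIn Finset.univ v = 28 := by simp [hd, hV]
      rw [this] at h2
      rw [hau]
      linarith
    · simp [adjInt, ha]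
  -- `t u w` is `4` for `u = w` and `3` for non-adjacent `u ≠ w`
  have h2 : ∀ u w, G.adjInt u w * t u w =
      t u w - 3 * (1 - G.adjInt u w) - if u = w then 1 else 0 := by
    intro u w
    rcases eq_or_ne u w with rfl | huw
    · have : t u u = 4 := by
        rw [← hdeg u, ht]
        exact Finset.sum_congr rfl fun v _ => by rw [← sq, adjInt_sq]
      simp [this]
    · by_cases ha : G.Adj u w
      · simp [adjInt, ha, huw]
      · have h3 : ∀ v, G.adjInt v u * G.adjInt v w = G.adjInt v u + G.adjInt v w - 1 +
            (if v = u then 1 else 0) + (if v = w then 1 else 0) := by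
          intro v
          rcases eq_or_ne v u with rfl | hvu
          · simp [adjInt, ha, huw]
          rcases eq_or_ne v w with rfl | hvw
          · simp [adjInt, ha, G.adj_comm v u, huw.symm]
          have := hc.adj_or_of_card_eq_seven hV (fun v => by
            have := hd v; rw [degIn_univ] at this; exact_mod_cast this) hvu hvw huw
          simp only [ha, or_false] at this
          rcases this with h | h <;> simp [adjInt, h, hvu, hvw]
        have h4 : t u w = 3 := by
          rw [ht]
          simp only [h3]
          rw [Finset.sum_add_distrib, Finset.sum_add_distrib, Finset.sum_sub_distrib,
            Finset.sum_add_distrib, hdeg, hdeg, hone]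
          simp
        simp [adjInt, ha, huw, h4]
  have h3 : ∀ u, ∑ w, G.adjInt u w * t u w = 6 := by
    intro u
    have h4 : ∑ w, t u w = 16 := by
      rw [ht, Finset.sum_comm]
      have : ∀ v, ∑ w, G.adjInt v u * G.adjInt v w = 4 * G.adjInt v u := fun v => by
        rw [← Finset.mul_sum, ← degIn, hd, mul_comm]
      rw [Finset.sum_congr rfl fun v _ => this v, ← Finset.mul_sum, hdeg]
      norm_num
    simp only [h2]
    rw [Finset.sum_sub_distrib, Finset.sum_sub_distrib, ← Finset.mul_sum, Finset.sum_sub_distrib,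
      h4, hone, ← degIn, hd]
    simp
  have h4 : ∑ u, ∑ w, (9 * G.adjInt u w - G.adjInt u w * t u w) = 210 := by
    have : ∀ u, ∑ w, (9 * G.adjInt u w - G.adjInt u w * t u w) = 30 := fun u => by
      rw [Finset.sum_sub_distrib, ← Finset.mul_sum, ← degIn, hd, h3]
      norm_num
    rw [Finset.sum_congr rfl fun u _ => this u]
    simp [hV]
  simp only [h1] at hsum
  rw [h4] at hsum
  norm_num at hsum

end Order7

/-! ### Graphs of order at most 5 -/

section Isomorphisms

variable [Fintype V]

theorem nonempty_iso_completeGraph {n : ℕ} (hV : Fintype.card V = n)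
    (h : ∀ u v : V, u ≠ v → G.Adj u v) : Nonempty (G ≃g completeGraph (Fin n)) := by
  refine ⟨⟨Fintype.equivFinOfCardEq hV, ?_⟩⟩
  intro u v
  simp only [completeGraph, top_adj, ne_eq, EmbeddingLike.apply_eq_iff_eq]
  exact ⟨h u v, fun h => h.ne⟩

theorem nonempty_iso_graphG2 (hV : Fintype.card V = 5) {p b q x e : V}
    (hpb : G.Adj p b) (hpq : G.Adj p q) (hbq : G.Adj b q) (hbx : G.Adj b x) (hxe : G.Adj x e)
    (npx : ¬ G.Adj p x) (npe : ¬ G.Adj p e) (nbe : ¬ G.Adj b e) (nqx : ¬ G.Adj q x)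
    (nqe : ¬ G.Adj q e) : Nonempty (G ≃g graphG2) := by
  have h1 : p ≠ x := by rintro rfl; exact npe hxe
  have h2 : p ≠ e := by rintro rfl; exact nbe hpb.symm
  have h3 : b ≠ e := by rintro rfl; exact npe hpb
  have h4 : q ≠ x := by rintro rfl; exact npx hpq
  have h5 : q ≠ e := by rintro rfl; exact nbe hbq
  have inj : Function.Injective ![p, b, q, x, e] := by
    intro i j hij
    fin_cases i <;> fin_cases j <;>
      simp_all [hpb.ne, hpq.ne, hbq.ne, hbx.ne, hxe.ne, hpb.ne', hpq.ne', hbq.ne', hbx.ne',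
        hxe.ne', h1.symm, h2.symm, h3.symm, h4.symm, h5.symm]
  have bij : Function.Bijective ![p, b, q, x, e] :=
    (Fintype.bijective_iff_injective_and_card _).2 ⟨inj, by simp [hV]⟩
  refine ⟨Iso.symm ⟨Equiv.ofBijective _ bij, ?_⟩⟩
  intro i j
  fin_cases i <;> fin_cases j <;>
    simp [graphG2, hpb, hpq, hbq, hbx, hxe, npx, npe, nbe, nqx, nqe, hpb.symm, hpq.symm, hbq.symm,
      hbx.symm, hxe.symm, G.adj_comm x p, G.adj_comm e p, G.adj_comm e b, G.adj_comm x q,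
      G.adj_comm e q]

end Isomorphisms

section SmallOrder

variable [Fintype V] [DecidableEq V] [DecidableRel G.Adj]

/-- In a connected claw-free graph of order 5 with degree sum 10 and sum of squared degrees 22, the
degrees are `3, 2, 2, 2, 1`, and the graph is a triangle with a path attached. -/
theorem NoClaw.nonempty_iso_graphG2 (hc : G.NoClaw) (hV : Fintype.card V = 5)
    (h1 : ∑ v, G.degIn Finset.univ v = 10) (h2 : ∑ v, G.degIn Finset.univ v ^ 2 = 22) :
    Nonempty (G ≃g graphG2) := by
  simp only [degIn_univ] at h1 h2
  -- the deviations `d - 2` are a single `1`, a single `-1` and zeros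
  have hdev : ∑ v, ((G.degree v : ℤ) - 2) ^ 2 = 2 := by
    have : ∀ v, ((G.degree v : ℤ) - 2) ^ 2 = (G.degree v : ℤ) ^ 2 - 4 * G.degree v + 4 :=
      fun v => by ring
    simp only [this]
    rw [Finset.sum_add_distrib, Finset.sum_sub_distrib, ← Finset.mul_sum, h1, h2]
    simp [hV]
  have hdev0 : ∑ v, ((G.degree v : ℤ) - 2) = 0 := by
    rw [Finset.sum_sub_distrib, h1]
    simp [hV]
  have hle : ∀ v, ((G.degree v : ℤ) - 2) ^ 2 ≤ 2 := fun v =>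
    hdev ▸ Finset.single_le_sum (f := fun v => ((G.degree v : ℤ) - 2) ^ 2)
      (fun w _ => sq_nonneg _) (Finset.mem_univ v)
  have hrange : ∀ v, (G.degree v : ℤ) - 2 = -1 ∨ (G.degree v : ℤ) - 2 = 0 ∨
      (G.degree v : ℤ) - 2 = 1 := by
    intro v
    have := hle v
    have : (G.degree v : ℤ) - 2 ≤ 1 := by nlinarith
    have : -1 ≤ (G.degree v : ℤ) - 2 := by nlinarith
    omega
  have hplus : ∑ v, (((G.degree v : ℤ) - 2) ^ 2 + ((G.degree v : ℤ) - 2)) = 2 := by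
    rw [Finset.sum_add_distrib, hdev, hdev0]; rfl
  have hminus : ∑ v, (((G.degree v : ℤ) - 2) ^ 2 - ((G.degree v : ℤ) - 2)) = 2 := by
    rw [Finset.sum_sub_distrib, hdev, hdev0]; rfl
  obtain ⟨b, hb⟩ : ∃ b, G.degree b = 3 := by
    by_contra! hno
    rw [Finset.sum_eq_zero] at hplus
    · norm_num at hplus
    · intro v _
      have := hno v
      rcases hrange v with h | h | h
      · rw [h]; rfl
      · rw [h]; rfl
      · omega
  obtain ⟨e, he⟩ : ∃ e, G.degree e = 1 := by
    by_contra! hno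
    rw [Finset.sum_eq_zero] at hminus
    · norm_num at hminus
    · intro v _
      have := hno v
      rcases hrange v with h | h | h
      · omega
      · rw [h]; rfl
      · rw [h]; rfl
  have hbe : b ≠ e := by rintro rfl; omega
  have hrest : ∀ v, v ≠ b → v ≠ e → G.degree v = 2 := by
    intro v hvb hve
    rw [← Finset.add_sum_erase _ _ (Finset.mem_univ b),
      ← Finset.add_sum_erase _ _ (Finset.mem_erase.2 ⟨hbe.symm, Finset.mem_univ e⟩),
      ← Finset.add_sum_erase _ _ (Finset.mem_erase.2 ⟨hve, Finset.mem_erase.2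
        ⟨hvb, Finset.mem_univ v⟩⟩), hb, he] at hdev
    have h0 : 0 ≤ ∑ w ∈ ((Finset.univ.erase b).erase e).erase v, ((G.degree w : ℤ) - 2) ^ 2 :=
      Finset.sum_nonneg fun w _ => sq_nonneg _
    push_cast at hdev
    have h1 : ((G.degree v : ℤ) - 2) ^ 2 = 0 := by nlinarith [sq_nonneg ((G.degree v : ℤ) - 2)]
    have h2 := pow_eq_zero_iff (two_ne_zero) |>.1 h1
    omega
  have hcard := fun v => G.card_neighborFinset_eq_degree v
  have hno3 : ∀ v, G.degree v = 2 → ∀ x y z, G.Adj v x → G.Adj v y → G.Adj v z → x ≠ y → x ≠ z →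
      y ≠ z → False := by
    intro v hv x y z hx hy hz hxy hxz hyz
    have hsub : ({x, y, z} : Finset V) ⊆ G.neighborFinset v := by
      intro w hw
      simp only [Finset.mem_insert, Finset.mem_singleton] at hw
      rw [mem_neighborFinset]
      rcases hw with rfl | rfl | rfl <;> assumption
    have := Finset.card_le_card hsub
    rw [hcard, hv, Finset.card_eq_three.2 ⟨x, y, z, hxy, hxz, hyz, rfl⟩] at this
    omega
  obtain ⟨x, hx⟩ := Finset.card_eq_one.1 ((hcard e).trans he)
  have hex : ∀ y, G.Adj e y ↔ y = x := fun y => by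
    rw [← mem_neighborFinset, hx, Finset.mem_singleton]
  by_cases hxb : x = b
  · -- the end vertex cannot hang on the vertex of degree three
    subst hxb
    exfalso
    have heN : e ∈ G.neighborFinset x := by
      rw [mem_neighborFinset]; exact ((hex x).2 rfl).symm
    obtain ⟨p, q, hpq, hN⟩ := Finset.card_eq_two.1
      (by rw [Finset.card_erase_of_mem heN, hcard, hb] : ((G.neighborFinset x).erase e).card = 2)
    have hxN : ∀ y, y ≠ e ∧ G.Adj x y ↔ y = p ∨ y = q := fun y => by
      rw [← mem_neighborFinset, ← Finset.mem_erase, hN]; simp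
    obtain ⟨hpe, hxp⟩ := (hxN p).2 (Or.inl rfl)
    obtain ⟨hqe, hxq⟩ := (hxN q).2 (Or.inr rfl)
    have hadj : G.Adj p q := by
      rcases hc x e p q ((hex x).2 rfl).symm hxp hxq hpe.symm hqe.symm hpq with h | h | h
      · exact absurd ((hex p).1 h) hxp.ne'
      · exact absurd ((hex q).1 h) hxq.ne'
      · exact h
    obtain ⟨y, hy⟩ : ∃ y, y ∉ ({x, e, p, q} : Finset V) := by
      by_contra! hall
      have : Fintype.card V ≤ 4 := by
        rw [← Finset.card_univ]
        exact (Finset.card_le_card fun v _ => hall v).trans Finset.card_le_four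
      omega
    simp only [Finset.mem_insert, Finset.mem_singleton, not_or] at hy
    obtain ⟨hyx, hye, hyp, hyq⟩ := hy
    obtain ⟨z, hz⟩ : (G.neighborFinset y).Nonempty := by
      rw [← Finset.card_pos, hcard, hrest y hyx hye]; norm_num
    rw [mem_neighborFinset] at hz
    by_cases hzx : z = x
    · subst hzx
      rcases (hxN y).1 ⟨hye, hz.symm⟩ with h | h
      · exact hyp h
      · exact hyq h
    by_cases hze : z = e
    · subst hze
      exact hyx ((hex y).1 hz.symm)
    by_cases hzp : z = p
    · subst hzp
      exact hno3 z (hrest z hzx hze) x q y hxp.symm hadj hz.symm hxq.ne (Ne.symm hyx) (Ne.symm hyq)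
    by_cases hzq : z = q
    · subst hzq
      exact hno3 z (hrest z hzx hze) x p y hxq.symm hadj.symm hz.symm hxp.ne (Ne.symm hyx) (Ne.symm hyp)
    have : Finset.card ({x, e, p, q, y, z} : Finset V) = 6 := by
      rw [Finset.card_insert_of_notMem, Finset.card_insert_of_notMem,
        Finset.card_insert_of_notMem, Finset.card_insert_of_notMem, Finset.card_pair hz.ne] <;>
      simp [hpq, hxp.ne, hxq.ne, hbe, hpe.symm, hqe.symm, Ne.symm hyx, Ne.symm hye, Ne.symm hyp,
        Ne.symm hyq, Ne.symm hzx, Ne.symm hze, Ne.symm hzp, Ne.symm hzq]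
    have h6 := Finset.card_le_univ ({x, e, p, q, y, z} : Finset V)
    omega
  · -- `x` joins `e` to `b`, and by claw-freeness the other two neighbours of `b` are adjacent
    have hxe : G.Adj x e := ((hex x).2 rfl).symm
    have hnbe : ¬ G.Adj b e := fun h => hxb ((hex b).1 h.symm).symm
    have hNb : G.neighborFinset b = (Finset.univ.erase b).erase e := by
      refine Finset.eq_of_subset_of_card_le (fun v hv => ?_) ?_
      · rw [mem_neighborFinset] at hv
        simp only [Finset.mem_erase, Finset.mem_univ, and_true]
        refine ⟨?_, hv.ne'⟩
        rintro rfl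
        exact hnbe hv
      · have := MatchRec.card_erase_erase (Finset.mem_univ b) (Finset.mem_univ e) hbe
        rw [Finset.card_univ, hV] at this
        rw [hcard, hb]
        omega
    have hbx : G.Adj b x := by
      rw [← mem_neighborFinset, hNb]
      simp [hxb, hxe.ne]
    obtain ⟨p, q, hpq, hN⟩ := Finset.card_eq_two.1
      (by rw [Finset.card_erase_of_mem ((G.mem_neighborFinset b x).2 hbx), hcard, hb] :
        ((G.neighborFinset b).erase x).card = 2)
    have hbN : ∀ y, y ≠ x ∧ G.Adj b y ↔ y = p ∨ y = q := fun y => by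
      rw [← mem_neighborFinset, ← Finset.mem_erase, hN]; simp
    obtain ⟨hpx, hbp⟩ := (hbN p).2 (Or.inl rfl)
    obtain ⟨hqx, hbq⟩ := (hbN q).2 (Or.inr rfl)
    have hx2 := hrest x hxb hxe.ne
    have hpe : ¬ G.Adj p e := fun h => hpx ((hex p).1 h.symm)
    have hqe : ¬ G.Adj q e := fun h => hqx ((hex q).1 h.symm)
    have hpe' : p ≠ e := by rintro rfl; exact hnbe hbp
    have hqe' : q ≠ e := by rintro rfl; exact hnbe hbq
    have hpx' : ¬ G.Adj p x := fun h =>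
      hno3 x hx2 b e p hbx.symm hxe h.symm hbe hbp.ne hpe'.symm
    have hqx' : ¬ G.Adj q x := fun h =>
      hno3 x hx2 b e q hbx.symm hxe h.symm hbe hbq.ne hqe'.symm
    have hadj : G.Adj p q := by
      rcases hc b p q x hbp hbq hbx hpq hpx hqx with h | h | h
      · exact h
      · exact absurd h hpx'
      · exact absurd h hqx'
    exact SimpleGraph.nonempty_iso_graphG2 hV hbp.symm hadj hbq hbx hxe hpx' hpe hnbe hqx' hqe

end SmallOrder

end SimpleGraph

/-! ### The classification -/

theorem mainTheorem6 {V : Type*} [Finite V] (G : SimpleGraph V)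
    (hconn : G.Connected) (hint : G.IsMatchingIntegral) (hclaw : G.IsClawFree) :
    Nonempty (G ≃g SimpleGraph.completeGraph (Fin 1)) ∨
    Nonempty (G ≃g SimpleGraph.completeGraph (Fin 2)) ∨
    Nonempty (G ≃g SimpleGraph.graphG2) := by
  classical
  have := Fintype.ofFinite V
  obtain ⟨T, ε, hε, hT, hV, hμ⟩ := SimpleGraph.exists_matchingPolynomial_eq_prod hconn hint hclaw
  have hV' : (Fintype.card V : ℤ) = 2 * T.card + ε := by exact_mod_cast hV
  have hpos : 0 < Fintype.card V := Fintype.card_pos_iff.2 hconn.nonempty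
  rcases Nat.lt_or_ge T.card 1 with h0 | h1
  · refine Or.inl (SimpleGraph.nonempty_iso_completeGraph (by omega) fun u v huv => ?_)
    exact absurd (Fintype.card_le_one_iff.1 (by omega) u v) huv
  have hsum := SimpleGraph.sum_degIn_eq hV h1 hμ
  have hlow : (Fintype.card V : ℤ) ≤ 2 * ∑ a ∈ T, a ^ 2 := by
    rw [← hsum]
    have := Finset.sum_le_sum fun v (_ : v ∈ Finset.univ) => hconn.one_le_degIn (by omega) v
    simpa using this
  have hupp : 2 * ∑ a ∈ T, a ^ 2 ≤ (2 * T.card + ε : ℤ) * (2 * T.card + ε - 1) := by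
    rw [← hsum, ← hV']
    have := Finset.sum_le_sum fun v (_ : v ∈ Finset.univ) =>
      SimpleGraph.degIn_univ_le (G := G) v
    simpa [mul_sub] using this
  rcases Nat.lt_or_ge T.card 2 with h2 | h2
  · -- `a = 1`, so there is one edge, which cannot connect three vertices
    obtain ⟨a, rfl⟩ := Finset.card_eq_one.1 (by omega : T.card = 1)
    have ha := hT a (Finset.mem_singleton_self a)
    simp only [Finset.sum_singleton, Finset.card_singleton, Nat.cast_one] at hlow hupp hV' hV
    have ha1 : a = 1 := by
      have : (ε : ℤ) ≤ 1 := by exact_mod_cast hε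
      have : (0 : ℤ) ≤ ε := by positivity
      have : a < 2 := by nlinarith
      omega
    subst ha1
    have hV2 : Fintype.card V = 2 := by omega
    refine Or.inr (Or.inl (SimpleGraph.nonempty_iso_completeGraph hV2 fun u v huv => ?_))
    have := hconn.one_le_degIn (by omega) u
    rw [SimpleGraph.degIn_univ, ← G.card_neighborFinset_eq_degree] at this
    obtain ⟨w, hw⟩ := Finset.card_pos.1 (by omega : 0 < (G.neighborFinset u).card)
    rw [SimpleGraph.mem_neighborFinset] at hw
    have hwv : w = v := by
      by_contra hne
      have h3 := Finset.card_le_univ ({u, w, v} : Finset V)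
      rw [Finset.card_eq_three.2 ⟨u, w, v, hw.ne, huv, hne, rfl⟩] at h3
      omega
    exact hwv ▸ hw
  have hsq := SimpleGraph.sum_degIn_sq_eq hV h2 hμ
  obtain ⟨rfl, hT'⟩ := SimpleGraph.eq_of_sum_sq_le hT h2 hε hupp
    (by
      have := sq_sum_le_card_mul_sum_sq (s := Finset.univ)
        (f := fun v => G.degIn Finset.univ v)
      rwa [hsum, hsq, Finset.card_univ, hV'] at this)
    (by
      rw [← hsq, ← hsum, ← hV', Finset.mul_sum]
      refine Finset.sum_le_sum fun v _ => ?_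
      rw [sq]
      exact mul_le_mul_of_nonneg_right (SimpleGraph.degIn_univ_le v)
        (SimpleGraph.degIn_univ_nonneg v))
  rcases hT' with rfl | rfl
  · exact Or.inr (Or.inr (hclaw.noClaw.nonempty_iso_graphG2 (hV.trans (by decide))
      (hsum.trans (by decide)) (hsq.trans (by decide))))
  · exfalso
    have hV7 : Fintype.card V = 7 := hV.trans (by decide)
    have hs : ∑ v, G.degIn Finset.univ v = 28 := hsum.trans (by decide)
    have hq : ∑ v, G.degIn Finset.univ v ^ 2 = 112 := hsq.trans (by decide)
    refine hclaw.noClaw.coeff_one_ne hV7 (fun v => ?_) ?_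
    · -- equality in the Cauchy–Schwarz inequality: all degrees are equal to their mean
      have h3 : ∑ v, (G.degIn Finset.univ v - 4) ^ 2 = 0 := by
        have : ∀ v, (G.degIn Finset.univ v - 4) ^ 2 =
            G.degIn Finset.univ v ^ 2 - 8 * G.degIn Finset.univ v + 16 := fun v => by ring
        simp only [this]
        rw [Finset.sum_add_distrib, Finset.sum_sub_distrib, ← Finset.mul_sum, hs, hq]
        simp [hV7]
      have h4 := (Finset.sum_eq_zero_iff_of_nonneg fun v _ => sq_nonneg _).1 h3 v
        (Finset.mem_univ v)
      have := pow_eq_zero_iff (two_ne_zero) |>.1 h4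
      omega
    · have := SimpleGraph.coeff_pow_mul_prod {1, 2, 3} 1 0
      rw [← hμ, coeff_zero_eq_eval_zero, eval_prod] at this
      rw [show 2 * 0 + 1 = 1 from rfl] at this
      rw [this]
      simp
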